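/- **Lemma 4.15 (Front View).** Let $S$ be a topological circle with a fixed orientation (for instance $S=\partial\Gamma$, the Gromov boundary of a closed surface group $\Gamma$), and write $(a,b)$ for the open arc of $S$ going from $a$ to $b$ in the positive direction, $(a,b]=(a,b)\cup\{b\}$, $[a,b)=\{a\}\cup(a,b)$. For an $n$-dimensional real vector space $V$, a continuous map $\xi=(\xi^1,\dots,\xi^{n-1})$ from $S$, or from an interval (arc) $I$ of $S$, to the manifold of full flags of $V$ is called a *hyperconvex Frenet curve* if, with the conventions $\xi^0=0$, $\xi^n=V$, for all $k_1,\dots,k_j$ with $p=k_1+\dots+k_j\le n$: (i) for all distinct points $x_1,\dots,x_j$ the sum $\xi^{k_1}(x_1)+\dots+\xi^{k_j}(x_j)$ is direct; (ii) for every point $x$ and every sequence $(x_1^m,\dots,x_j^m)_m$ of $j$-tuples of distinct points converging to $(x,\dots,x)$, $\lim_{m\to\infty}\bigoplus_{l=1}^j\xi^{k_l}(x_l^m)=\xi^p(x)$. Let $\xi=(\xi^1,\xi^2,\xi^3)$ be a hyperconvex Frenet curve from $S$ to the full flags of $\mathbb{R}^4$ and let $x\ne y$ be points of $S$. Put $p_{xy}=\xi^2(x)\cap\xi^3(y)$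 and $P_{xy}=\xi^2(y)\oplus\xi^1(x)$. Then $\dim p_{xy}=1$, $\dim P_{xy}=3$, $\mathbb{R}^4=p_{xy}\oplus P_{xy}$, and $$\sigma_{xy}^1(w)=(p_{xy}\oplus\xi^1(w))\cap P_{xy},\qquad \sigma_{xy}^2(w)=(p_{xy}\oplus\xi^2(w))\cap P_{xy}\qquad(w\in S-\{x\})$$ define a map $\sigma_{xy}=(\sigma_{xy}^1,\sigma_{xy}^2)$ from $S-\{x\}$ to the full flags of $P_{xy}$. Moreover: 1. $\sigma_{xy}^1$ and $\sigma_{xy}^2$ are continuous injections. 2. The restrictions of $\sigma_{xy}$ to $(x,y]$ and to $[y,x)$ are hyperconvex Frenet curves. 3. The image $\sigma_{xy}^1(S-\{x\})$ in the projective plane $\mathbb{P}(P_{xy})$ is $C^1$ at the point $\xi^1(y)$, i.e. it is an embedded $C^1$ curve in a neighborhood of $\xi^1(y)$; its tangent line there is $\xi^2(y)$, and it crosses this line at $\xi^1(y)$, i.e. near $\xi^1(y)$ the two components of the curve minus $\xi^1(y)$ lie strictly on different sides of $\xi^2(y)$. -/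

import Mathlib

open Set Filter Topology

namespace FrenetCurve

section Flags

variable (V : Type*) [NormedAddCommGroup V] [NormedSpace ℝ V]

/-- Linearly independent `k`-tuples of vectors, for all `k` together. -/
abbrev Frame : Type _ := Σ k : ℕ, {v : Fin k → V // LinearIndependent ℝ v}

variable {V}

/-- The topology on the set of (finite-dimensional) linear subspaces of `V`: the disjoint union of
the Grassmannians `Gr_k(V)`, each with its usual topology, the quotient topology under the map that
takes a linearly independent `k`-tuple to its span. -/
instance subspaceTopology : TopologicalSpace (Submodule ℝ V) :=
  TopologicalSpace.coinduced (fun v : Frame V => Submodule.span ℝ (range v.2.1)) inferInstance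

variable (V)

/-- Full flags in a finite-dimensional real vector space `V` of dimension `n`: nested subspaces
`piece k` of dimension `k` for `k ≤ n`. By convention `piece 0 = 0`, and `piece k = V` for
`k ≥ n`, so that the flag is determined by `piece 1, …, piece (n - 1)`. -/
@[ext]
structure FullFlag [FiniteDimensional ℝ V] where
  piece : ℕ → Submodule ℝ V
  mono : Monotone piece
  finrank_piece : ∀ k, Module.finrank ℝ (piece k) = min k (Module.finrank ℝ V)

variable {V} [FiniteDimensional ℝ V]

/-- The topology of the flag manifold, as a subspace of the product of the Grassmannians. -/
instance flagTopology : TopologicalSpace (FullFlag V) :=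
  TopologicalSpace.induced FullFlag.piece inferInstance

/-- Hyperconvex Frenet curves `ξ = (ξ¹, …, ξⁿ⁻¹) : I → F(V)`, where `ξᵏ(x)` is `(ξ x).piece k`. -/
structure IsHyperconvexFrenet {I : Type*} [TopologicalSpace I] (ξ : I → FullFlag V) : Prop where
  continuous : Continuous ξ
  /-- For distinct points `x₁, …, x_j` and `k₁ + ⋯ + k_j ≤ n`, the sum
  `ξ^{k₁}(x₁) + ⋯ + ξ^{k_j}(x_j)` is direct. -/
  general_position : ∀ (j : ℕ) (k : Fin j → ℕ) (x : Fin j → I),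
    ∑ l, k l ≤ Module.finrank ℝ V → Function.Injective x →
    iSupIndep fun l => (ξ (x l)).piece (k l)
  /-- If `p = k₁ + ⋯ + k_j ≤ n` and `j`-tuples of distinct points converge to `(x, …, x)`, then
  the corresponding sums of subspaces converge to `ξᵖ(x)`. -/
  limit_compatibility : ∀ (j : ℕ) (k : Fin j → ℕ) (x : I) (u : ℕ → Fin j → I),
    ∑ l, k l ≤ Module.finrank ℝ V → (∀ m, Function.Injective (u m)) →
    (∀ l, Tendsto (fun m => u m l) atTop (𝓝 x)) →
    Tendsto (fun m => ⨆ l, (ξ (u m l)).piece (k l)) atTop (𝓝 ((ξ x).piece (∑ l, k l)))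

end Flags

section PlaneCurves

variable {V : Type*} [NormedAddCommGroup V] [NormedSpace ℝ V]

/-- `C` is a set of points of the projective space `ℙ(V)` (lines through `0` in `V`), and `c` a
point of it. The map `t ↦ [γ t]`, for `|t| < ε`, is a `C¹` regular parametrization of `C` near `c`:
it is a `C¹` immersion into `ℙ(V)` (that is, `γ` is `C¹`, and `γ t`, `γ' t` are always linearly
independent), it is a homeomorphism onto its image, this image is contained in `C` and contains all
points of `C` near `c`, and `[γ 0] = c`. -/
structure IsC1LocalParam (C : Set (Submodule ℝ V)) (c : Submodule ℝ V) (ε : ℝ) (γ : ℝ → V) :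
    Prop where
  pos : 0 < ε
  contDiffOn : ContDiffOn ℝ 1 γ (Ioo (-ε) ε)
  immersion : ∀ t ∈ Ioo (-ε) ε, LinearIndependent ℝ ![γ t, deriv γ t]
  isEmbedding : IsEmbedding fun t : Ioo (-ε) ε => Submodule.span ℝ {γ t}
  image_subset : ∀ t ∈ Ioo (-ε) ε, Submodule.span ℝ {γ t} ∈ C
  image_mem_nhdsWithin : (fun t => Submodule.span ℝ {γ t}) '' Ioo (-ε) ε ∈ 𝓝[C] c
  center : Submodule.span ℝ {γ 0} = c

/-- The set `C ⊆ ℙ(V)` is, near its point `c`, an embedded `C¹` curve, whose tangent line at `c` is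
the projective line `L` (a two-dimensional linear subspace of `V`). -/
def IsC1AtWithTangent (C : Set (Submodule ℝ V)) (c L : Submodule ℝ V) : Prop :=
  ∃ (ε : ℝ) (γ : ℝ → V), IsC1LocalParam C c ε γ ∧ L = Submodule.span ℝ {γ 0, deriv γ 0}

/-- The curve `C` in the projective plane `ℙ(V)` crosses the projective line `L` at its point `c`:
near `c`, the two components of `C - {c}` lie strictly on different sides of `L`. -/
def CrossesLineAt (C : Set (Submodule ℝ V)) (c L : Submodule ℝ V) : Prop :=
  ∃ (ε : ℝ) (γ : ℝ → V), IsC1LocalParam C c ε γ ∧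
    ∃ φ : V →ₗ[ℝ] ℝ, LinearMap.ker φ = L ∧
      (∀ t ∈ Ioo (-ε) 0, φ (γ t) < 0) ∧ (∀ t ∈ Ioo 0 ε, 0 < φ (γ t))

end PlaneCurves

section FrontView

variable {X : Type*}

/-- The point `p_xy = ξ²(x) ∩ ξ³(y)`. -/
def viewPoint (ξ : X → FullFlag (Fin 4 → ℝ)) (x y : X) : Submodule ℝ (Fin 4 → ℝ) :=
  (ξ x).piece 2 ⊓ (ξ y).piece 3

/-- The plane `P_xy = ξ²(y) ⊕ ξ¹(x)`. -/
def viewPlane (ξ : X → FullFlag (Fin 4 → ℝ)) (x y : X) : Submodule ℝ (Fin 4 → ℝ) :=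
  (ξ y).piece 2 ⊔ (ξ x).piece 1

/-- `σ_xyᵏ(w) = (p_xy ⊕ ξᵏ(w)) ∩ P_xy`, as a subspace of `P_xy`. -/
def frontProj (ξ : X → FullFlag (Fin 4 → ℝ)) (x y : X) (k : ℕ) (w : X) :
    Submodule ℝ (viewPlane ξ x y) :=
  (viewPoint ξ x y ⊔ (ξ w).piece k).submoduleOf (viewPlane ξ x y)

end FrontView

end FrenetCurve

/-! Choose a basis `e₀, e₁, e₂, e₃` of `ℝ⁴` adapted to the flag `ξ(x)`, with `e₀` in `ξ¹(x)` and
`e₁` in `p_xy`. In the affine chart where the last coordinate is `1`, the curve `ξ¹` becomes `(u, v,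
t)`. Transversality to `ξ²(x)` makes `t` injective on the circle minus `x`, so `t` serves as a
parameter on an open interval, and limits of secants show that the curve is `C¹` in `t`
(`IsFrontParam.hasDerivAt`). Projecting from `p_xy` forgets `v`, so `σ¹` is the graph of `u` over
`t`; this gives its injectivity and the `C¹` claim at once.

What remains is the convexity of `u`. Write `Δu`, `Δv` for second differences on increasing triples.
Three points of the curve are independent of `ξ¹(x)`, so `Δv` never vanishes; four points are
independent, so the determinant of `(u, v, 1, t)` never vanishes. Both therefore have constant sign,
and a determinant identity (`secondDiff_div_lt`) turns this into strict monotonicity of `Δu/Δv` in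
each argument. Since `p_xy` lies in `ξ³(y)`, the limit of the spans of three points near `y`, the
quotient tends to `0` at `y` (`IsFrontParam.tendsto_secondDiff_div`). So it has one sign before `y`
and the other after: `u` is strictly concave on one side and strictly convex on the other
(`secondDiff_sign`).

On each closed half, strict convexity says that no three points of the projected curve are collinear
and no tangent meets the curve again, which is general position in the plane. The limit condition
comes from continuity of the projection on subspaces that avoid `p_xy`; when the multiplicities add
up to `3` the sums are the whole space. At `y` itself the graph has an inflection and crosses its
tangent. -/

namespace FrenetCurve

/-! ### Grassmannians: affine charts and continuity of images -/

section GrassmannTopology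

variable {V : Type*} [NormedAddCommGroup V] [NormedSpace ℝ V]

lemma isOpen_submodule_iff {U : Set (Submodule ℝ V)} :
    IsOpen U ↔ ∀ k : ℕ, IsOpen {v : {v : Fin k → V // LinearIndependent ℝ v} |
      Submodule.span ℝ (range v.1) ∈ U} := by
  rw [isOpen_coinduced, isOpen_sigma_iff]
  rfl

lemma continuous_span (k : ℕ) :
    Continuous fun v : {v : Fin k → V // LinearIndependent ℝ v} =>
      Submodule.span ℝ (range v.1) := by
  have h : Continuous fun v : Frame V => Submodule.span ℝ (range v.2.1) := continuous_coinduced_rng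
  exact h.comp continuous_sigmaMk

/-- The point of `W` with image `c` under `Φ`, if it is unique, and `0` otherwise. -/
noncomputable def chartSection {F : Type*} [AddCommGroup F] [Module ℝ F] (Φ : V →ₗ[ℝ] F) (c : F)
    (W : Submodule ℝ V) : V :=
  open Classical in if h : ∃! z, z ∈ W ∧ Φ z = c then h.choose else 0

lemma chartSection_eq {F : Type*} [AddCommGroup F] [Module ℝ F] {Φ : V →ₗ[ℝ] F} {c : F}
    {W : Submodule ℝ V} (hW : Disjoint W (LinearMap.ker Φ)) {z : V} (hz : z ∈ W) (hc : Φ z = c) :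
    chartSection Φ c W = z := by
  have h : ∃! z, z ∈ W ∧ Φ z = c := by
    refine ⟨z, ⟨hz, hc⟩, fun y hy => ?_⟩
    have := Submodule.disjoint_def.1 hW (y - z) (W.sub_mem hy.1 hz) (by simp [hy.2, hc])
    exact sub_eq_zero.1 this
  rw [chartSection, dif_pos h]
  exact h.unique h.choose_spec.1 ⟨hz, hc⟩

lemma exists_mem_map_eq {k : ℕ} {Φ : V →ₗ[ℝ] Fin k → ℝ} {W : Submodule ℝ V}
    (hk : Module.finrank ℝ W = k) (hW : Disjoint W (LinearMap.ker Φ)) (c : Fin k → ℝ) :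
    ∃ z ∈ W, Φ z = c := by
  rcases Nat.eq_zero_or_pos k with rfl | hpos
  · exact ⟨0, W.zero_mem, Subsingleton.elim _ _⟩
  have : Module.Finite ℝ W := Module.finite_of_finrank_pos (by omega)
  have hinj : Function.Injective (Φ.domRestrict W) := by
    rw [← LinearMap.ker_eq_bot, LinearMap.ker_eq_bot']
    intro z hz
    exact Subtype.ext (Submodule.disjoint_def.1 hW z z.2 hz)
  obtain ⟨z, hz⟩ := (LinearMap.injective_iff_surjective_of_finrank_eq_finrank
    (by simpa using hk)).1 hinj c
  exact ⟨z, z.2, hz⟩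

lemma chartSection_spec {k : ℕ} {Φ : V →ₗ[ℝ] Fin k → ℝ} {W : Submodule ℝ V}
    (hk : Module.finrank ℝ W = k) (hW : Disjoint W (LinearMap.ker Φ)) (c : Fin k → ℝ) :
    chartSection Φ c W ∈ W ∧ Φ (chartSection Φ c W) = c := by
  obtain ⟨z, hz, hc⟩ := exists_mem_map_eq hk hW c
  rw [chartSection_eq hW hz hc]
  exact ⟨hz, hc⟩

/-- The domain of the affine chart of the Grassmannian given by `Φ`. -/
def chartDomain {k : ℕ} (Φ : V →L[ℝ] Fin k → ℝ) : Set (Submodule ℝ V) :=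
  {W | Module.finrank ℝ W = k ∧ Disjoint W (LinearMap.ker (Φ : V →ₗ[ℝ] Fin k → ℝ))}

/-- The matrix of the images under `Φ` of `k` vectors. -/
def chartMatrix {k : ℕ} (Φ : V →L[ℝ] Fin k → ℝ) (v : Fin k → V) : Matrix (Fin k) (Fin k) ℝ :=
  Matrix.of fun i j => Φ (v i) j

lemma vecMul_chartMatrix {k : ℕ} (Φ : V →L[ℝ] Fin k → ℝ) (v : Fin k → V) (a : Fin k → ℝ) :
    Matrix.vecMul a (chartMatrix Φ v) = Φ (∑ i, a i • v i) := by
  ext j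
  simp [Matrix.vecMul, dotProduct, chartMatrix]

lemma span_mem_chartDomain_iff {k : ℕ} (Φ : V →L[ℝ] Fin k → ℝ) {v : Fin k → V}
    (hv : LinearIndependent ℝ v) :
    Submodule.span ℝ (range v) ∈ chartDomain Φ ↔ (chartMatrix Φ v).det ≠ 0 := by
  have h1 : Module.finrank ℝ (Submodule.span ℝ (range v)) = k := by
    simpa using finrank_span_eq_card hv
  constructor
  · rintro ⟨-, hd⟩ hdet
    obtain ⟨a, ha, h⟩ := Matrix.exists_vecMul_eq_zero_iff.2 hdet
    rw [vecMul_chartMatrix] at h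
    have := Submodule.disjoint_def.1 hd (∑ i, a i • v i)
      (Submodule.sum_mem _ fun i _ => Submodule.smul_mem _ _ (Submodule.subset_span ⟨i, rfl⟩)) h
    exact ha (funext fun i => Fintype.linearIndependent_iff.1 hv a this i)
  · intro hdet
    refine ⟨h1, Submodule.disjoint_def.2 fun z hz hΦ => ?_⟩
    obtain ⟨a, rfl⟩ := (Submodule.mem_span_range_iff_exists_fun ℝ).1 hz
    have : a = 0 := by
      by_contra ha
      refine hdet (Matrix.exists_vecMul_eq_zero_iff.1 ⟨a, ha, ?_⟩)
      rw [vecMul_chartMatrix]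
      exact hΦ
    simp [this]

lemma continuous_chartMatrix {k : ℕ} (Φ : V →L[ℝ] Fin k → ℝ) :
    Continuous fun v : {v : Fin k → V // LinearIndependent ℝ v} => chartMatrix Φ v.1 := by
  refine continuous_matrix fun i j => ?_
  exact (continuous_apply j).comp
    (Φ.continuous.comp ((continuous_apply i).comp continuous_subtype_val))

/-- The span of an independent `i`-tuple has dimension `i`, so a chart domain lives in one
Grassmannian and only frames of `k` vectors have to be tested. -/
lemma isOpen_inter_chartDomain {k : ℕ} (Φ : V →L[ℝ] Fin k → ℝ) {A : Set (Submodule ℝ V)}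
    (hA : IsOpen {v : {v : Fin k → V // LinearIndependent ℝ v} |
      (chartMatrix Φ v.1).det ≠ 0 ∧ Submodule.span ℝ (range v.1) ∈ A}) :
    IsOpen (chartDomain Φ ∩ A) := by
  rw [isOpen_submodule_iff]
  intro i
  rcases eq_or_ne i k with rfl | hik
  · convert hA using 3 with v
    rw [mem_inter_iff, span_mem_chartDomain_iff Φ v.2]
  · convert isOpen_empty using 1
    refine eq_empty_of_forall_notMem fun v hv => hik ?_
    rw [← hv.1.1]
    simpa using (finrank_span_eq_card v.2).symm

lemma isOpen_chartDomain {k : ℕ} (Φ : V →L[ℝ] Fin k → ℝ) : IsOpen (chartDomain Φ) := by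
  have := isOpen_inter_chartDomain Φ (A := univ) (by
    simp only [mem_univ, and_true]
    exact isOpen_ne.preimage (continuous_chartMatrix Φ).matrix_det)
  simpa using this

/-- Cramer's rule: the coefficients solve `a · M = c` for the chart matrix `M`. Adjugate and
determinant depend continuously on the frame, hence so does the section. -/
lemma chartSection_span {k : ℕ} (Φ : V →L[ℝ] Fin k → ℝ) {v : Fin k → V}
    (hv : LinearIndependent ℝ v) (hdet : (chartMatrix Φ v).det ≠ 0) (c : Fin k → ℝ) :
    chartSection (Φ : V →ₗ[ℝ] Fin k → ℝ) c (Submodule.span ℝ (range v)) =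
      ∑ i, ((chartMatrix Φ v).det⁻¹ • Matrix.vecMul c (chartMatrix Φ v).adjugate) i • v i := by
  refine chartSection_eq ((span_mem_chartDomain_iff Φ hv).2 hdet).2
    (Submodule.sum_mem _ fun i _ => Submodule.smul_mem _ _ (Submodule.subset_span ⟨i, rfl⟩)) ?_
  rw [ContinuousLinearMap.coe_coe, ← vecMul_chartMatrix, Matrix.smul_vecMul, Matrix.vecMul_vecMul,
    Matrix.adjugate_mul, Matrix.vecMul_smul, Matrix.vecMul_one, smul_smul, inv_mul_cancel₀ hdet,
    one_smul]

theorem continuousOn_chartSection {k : ℕ} (Φ : V →L[ℝ] Fin k → ℝ) (c : Fin k → ℝ) :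
    ContinuousOn (chartSection (Φ : V →ₗ[ℝ] Fin k → ℝ) c) (chartDomain Φ) := by
  rw [continuousOn_open_iff (isOpen_chartDomain Φ)]
  intro O hO
  refine isOpen_inter_chartDomain Φ ?_
  have hopen : IsOpen {v : {v : Fin k → V // LinearIndependent ℝ v} |
      (chartMatrix Φ v.1).det ≠ 0} := isOpen_ne.preimage (continuous_chartMatrix Φ).matrix_det
  have hc : ContinuousOn (fun v : {v : Fin k → V // LinearIndependent ℝ v} =>
      ∑ i, ((chartMatrix Φ v.1).det⁻¹ • Matrix.vecMul c (chartMatrix Φ v.1).adjugate) i • v.1 i)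
      {v | (chartMatrix Φ v.1).det ≠ 0} := by
    refine continuousOn_finsetSum _ fun i _ => ContinuousOn.smul ?_
      ((continuous_apply i).comp continuous_subtype_val).continuousOn
    simp only [Pi.smul_apply, smul_eq_mul]
    refine ContinuousOn.mul (ContinuousOn.inv₀
      (continuous_chartMatrix Φ).matrix_det.continuousOn fun v hv => hv) ?_
    have : Continuous fun v : {v : Fin k → V // LinearIndependent ℝ v} =>
        Matrix.vecMul c (chartMatrix Φ v.1).adjugate :=
      continuous_const.matrix_vecMul (continuous_chartMatrix Φ).matrix_adjugate
    exact ((continuous_apply i).comp this).continuousOn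
  convert hc.isOpen_inter_preimage hopen hO using 1
  ext v
  simp only [mem_ofPred_eq, mem_inter_iff, mem_preimage]
  refine and_congr_right fun hv => ?_
  rw [chartSection_span Φ v.2 hv c]

theorem continuousAt_chartSection {k : ℕ} {Φ : V →L[ℝ] Fin k → ℝ} (c : Fin k → ℝ)
    {W : Submodule ℝ V} (hW : W ∈ chartDomain Φ) :
    ContinuousAt (chartSection (Φ : V →ₗ[ℝ] Fin k → ℝ) c) W :=
  (continuousOn_chartSection Φ c).continuousAt ((isOpen_chartDomain Φ).mem_nhds hW)

lemma disjoint_span_ker_iff {V' : Type*} [NormedAddCommGroup V'] [NormedSpace ℝ V']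
    (π : V →L[ℝ] V') {k : ℕ} {v : Fin k → V} (hv : LinearIndependent ℝ v) :
    Disjoint (Submodule.span ℝ (range v)) (LinearMap.ker (π : V →ₗ[ℝ] V')) ↔
      LinearIndependent ℝ fun i => π (v i) := by
  refine ⟨fun h => hv.map h, fun h => Submodule.disjoint_def.2 fun z hz hπ => ?_⟩
  obtain ⟨a, rfl⟩ := (Submodule.mem_span_range_iff_exists_fun ℝ).1 hz
  have h0 : ∑ i, a i • π (v i) = 0 := by simpa using hπ
  have : a = 0 := funext fun i => Fintype.linearIndependent_iff.1 h a h0 i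
  simp [this]

/-- Taking images under a linear map is continuous at the subspaces on which it is injective. -/
theorem continuousAt_map {V' : Type*} [NormedAddCommGroup V'] [NormedSpace ℝ V']
    (π : V →L[ℝ] V') {W : Submodule ℝ V} (hW : Disjoint W (LinearMap.ker (π : V →ₗ[ℝ] V'))) :
    ContinuousAt (Submodule.map (π : V →ₗ[ℝ] V')) W := by
  -- Openness is tested on frames: there, avoiding the kernel is the open condition that the image
  -- tuple is independent, and that tuple is a frame of the image.
  have key : ∀ O : Set (Submodule ℝ V'), IsOpen O →
      IsOpen {W : Submodule ℝ V | Disjoint W (LinearMap.ker (π : V →ₗ[ℝ] V')) ∧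
        Submodule.map (π : V →ₗ[ℝ] V') W ∈ O} := by
    intro O hO
    rw [isOpen_submodule_iff]
    intro k
    have hpost : Continuous fun v : {v : Fin k → V // LinearIndependent ℝ v} =>
        fun i => π (v.1 i) :=
      continuous_pi fun i => π.continuous.comp ((continuous_apply i).comp continuous_subtype_val)
    have h1 : IsOpen {v : {v : Fin k → V // LinearIndependent ℝ v} |
        LinearIndependent ℝ fun i => π (v.1 i)} :=
      isOpen_setOfPred_linearIndependent.preimage hpost
    have h2 : Continuous fun v : {v : {v : Fin k → V // LinearIndependent ℝ v} |
        LinearIndependent ℝ fun i => π (v.1 i)} =>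
        Submodule.span ℝ (range fun i => π (v.1.1 i)) :=
      (continuous_span k).comp
        (Continuous.subtype_mk (hpost.comp continuous_subtype_val) fun v => v.2)
    convert h1.isOpenMap_subtype_val _ (hO.preimage h2) using 1
    ext v
    simp only [mem_ofPred_eq, mem_image, mem_preimage, Subtype.exists, exists_and_right,
      exists_eq_right]
    rw [disjoint_span_ker_iff π v.2, Submodule.map_span, ← range_comp, exists_prop]
    rfl
  intro O hO
  obtain ⟨O', hO', hopen, hmem⟩ := mem_nhds_iff.1 hO
  exact mem_map.2 (mem_of_superset ((key O' hopen).mem_nhds ⟨hW, hmem⟩) fun W' h => hO' h.2)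

end GrassmannTopology

/-! ### Limits of sums along filters -/

section Limits

variable {V : Type*} [NormedAddCommGroup V] [NormedSpace ℝ V] [FiniteDimensional ℝ V]
  {I : Type*} [TopologicalSpace I] {ξ : I → FullFlag V}

lemma FullFlag.piece_zero (F : FullFlag V) : F.piece 0 = ⊥ :=
  Submodule.finrank_eq_zero.1 (by simp [F.finrank_piece])

lemma IsHyperconvexFrenet.continuous_piece (h : IsHyperconvexFrenet ξ) (k : ℕ) :
    Continuous fun w => (ξ w).piece k :=
  (continuous_apply k).comp (continuous_induced_dom.comp h.continuous)

/-- This frees the limit condition from sequences, for use on punctured neighbourhoods and on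
increasing triples near a point. Injectivity holds only eventually, hence the shift by `N`. -/
lemma IsHyperconvexFrenet.tendsto (h : IsHyperconvexFrenet ξ) {ι : Type*} {l : Filter ι}
    [l.IsCountablyGenerated] {j : ℕ} (k : Fin j → ℕ) {x : I} {u : ι → Fin j → I}
    (hk : ∑ i, k i ≤ Module.finrank ℝ V) (hu : ∀ᶠ m in l, Function.Injective (u m))
    (hx : ∀ i, Tendsto (fun m => u m i) l (𝓝 x)) :
    Tendsto (fun m => ⨆ i, (ξ (u m i)).piece (k i)) l (𝓝 ((ξ x).piece (∑ i, k i))) := by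
  refine tendsto_of_seq_tendsto fun s hs => ?_
  obtain ⟨N, hN⟩ := eventually_atTop.1 (hs.eventually hu)
  refine (tendsto_add_atTop_iff_nat N).1 ?_
  exact h.limit_compatibility j k x (fun m => u (s (m + N))) hk (fun m => hN _ (by omega))
    fun i => ((hx i).comp hs).comp (tendsto_add_atTop_nat N)

end Limits

/-! ### Linear algebra of projections -/

section LinearAlgebra

variable {V V' : Type*} [AddCommGroup V] [Module ℝ V] [AddCommGroup V'] [Module ℝ V']

lemma iSupIndep_map {ι : Type*} (π : V →ₗ[ℝ] V') {W : ι → Submodule ℝ V} (hW : iSupIndep W)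
    (hd : Disjoint (⨆ i, W i) (LinearMap.ker π)) : iSupIndep fun i => (W i).map π := by
  classical
  rw [iSupIndep_iff_finsetSum_eq_zero_imp_eq_zero] at hW ⊢
  intro s v hv h0 i hi
  choose! z hz hzv using fun i hi => Submodule.mem_map.1 (hv i hi)
  have hsum : ∑ i ∈ s, z i = 0 := by
    refine Submodule.disjoint_def.1 hd _
      (Submodule.sum_mem _ fun i hi => Submodule.mem_iSup_of_mem i (hz i hi)) ?_
    rw [LinearMap.mem_ker, map_sum, ← h0]
    exact Finset.sum_congr rfl hzv
  rw [← hzv i hi, hW s z hz hsum i hi, map_zero]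

lemma finrank_iSup_le [FiniteDimensional ℝ V] {ι : Type*} [Fintype ι] (W : ι → Submodule ℝ V) :
    Module.finrank ℝ (⨆ i, W i : Submodule ℝ V) ≤ ∑ i, Module.finrank ℝ (W i) := by
  classical
  rw [← Finset.sup_univ_eq_iSup]
  induction (Finset.univ : Finset ι) using Finset.induction_on with
  | empty => simp
  | insert a s ha ih =>
    rw [Finset.sup_insert, Finset.sum_insert ha]
    exact (Submodule.finrank_add_le_finrank_add_finrank _ _).trans (by omega)

/-- A surjection that does not lower the dimension is injective. This yields directness of sums once
they are known to fill the plane `P_xy`. -/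
lemma disjoint_ker_of_map_eq_top [FiniteDimensional ℝ V] [FiniteDimensional ℝ V']
    (π : V →ₗ[ℝ] V') {W : Submodule ℝ V} (hW : W.map π = ⊤)
    (hr : Module.finrank ℝ W ≤ Module.finrank ℝ V') : Disjoint W (LinearMap.ker π) := by
  have hsurj : Function.Surjective (π.domRestrict W) := by
    intro z
    have : z ∈ W.map π := hW ▸ Submodule.mem_top
    obtain ⟨w, hw, rfl⟩ := this
    exact ⟨⟨w, hw⟩, rfl⟩
  have heq : Module.finrank ℝ W = Module.finrank ℝ V' :=
    le_antisymm hr (LinearMap.finrank_le_finrank_of_surjective hsurj)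
  have hinj := (LinearMap.injective_iff_surjective_of_finrank_eq_finrank heq).2 hsurj
  refine Submodule.disjoint_def.2 fun z hz hπ => ?_
  have : (⟨z, hz⟩ : W) = 0 := hinj (by simpa using hπ)
  simpa using this

/-- The description of `σ` by sums and intersections becomes a linear image, for which dimension,
independence and continuity are accessible. -/
lemma sup_submoduleOf_eq_map {P p : Submodule ℝ V} (h : IsCompl P p) (W : Submodule ℝ V) :
    (p ⊔ W).submoduleOf P = W.map (P.projectionOnto p h) := by
  ext q
  rw [Submodule.submoduleOf, Submodule.mem_comap, Submodule.subtype_apply, Submodule.mem_sup,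
    Submodule.mem_map]
  constructor
  · rintro ⟨a, ha, w, hw, haw⟩
    refine ⟨w, hw, ?_⟩
    rw [eq_sub_of_add_eq' haw, map_sub, Submodule.projectionOnto_apply_left,
      (Submodule.projectionOnto_apply_eq_zero_iff h).2 ha, sub_zero]
  · rintro ⟨w, hw, rfl⟩
    refine ⟨(P.projectionOnto p h w : V) - w, ?_, w, hw, by simp⟩
    rw [← Submodule.projectionOnto_apply_eq_zero_iff h, map_sub,
      Submodule.projectionOnto_apply_left, sub_self]

end LinearAlgebra

/-! ### The circle minus a point -/

section Circle

variable {X : Type*} [TopologicalSpace X] [CircularOrder X]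

/-- The coordinate is the length `r` of the positive arc from `x`. With representatives in `[a, a +
1)`, where `a` represents `x`, the cyclic order seen from `x` is the order of `(0, 1)`. -/
lemma exists_circle_coordinate (e : X ≃ₜ AddCircle (1 : ℝ))
    (he : ∀ a b c : X, btw (e a) (e b) (e c) ↔ btw a b c) (x : X) :
    ∃ q : ℝ → X, ContinuousOn q (Ioo 0 1) ∧ BijOn q (Ioo 0 1) {x}ᶜ ∧
      ∀ r ∈ Ioo (0 : ℝ) 1, ∀ s ∈ Ioo (0 : ℝ) 1, sbtw x (q r) (q s) → r < s := by
  obtain ⟨a, ha⟩ := QuotientAddGroup.mk_surjective (e x)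
  have ha' : ((a : ℝ) : AddCircle (1 : ℝ)) = e x := ha
  refine ⟨fun r => e.symm ((a + r : ℝ) : AddCircle (1 : ℝ)), ?_, ⟨?_, ?_, ?_⟩, ?_⟩
  · exact (e.symm.continuous.comp
      ((AddCircle.continuous_mk' 1).comp (continuous_const.add continuous_id))).continuousOn
  · intro r hr h
    have h1 : ((a + r : ℝ) : AddCircle (1 : ℝ)) = (a : ℝ) := by
      rw [ha', ← (h : _ = x), e.apply_symm_apply]
    have := (AddCircle.coe_eq_coe_iff_of_mem_Ico (p := (1 : ℝ)) (a := a)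
      ⟨by linarith [hr.1], by linarith [hr.2]⟩ ⟨le_rfl, by linarith⟩).1 h1
    linarith [hr.1]
  · intro r hr s hs h
    have h1 := e.symm.injective h
    have := (AddCircle.coe_eq_coe_iff_of_mem_Ico (p := (1 : ℝ)) (a := a)
      ⟨by linarith [hr.1], by linarith [hr.2]⟩ ⟨by linarith [hs.1], by linarith [hs.2]⟩).1 h1
    linarith
  · intro w hw
    have h1 := (AddCircle.equivIco (1 : ℝ) a (e w)).2
    have h2 : ((AddCircle.equivIco (1 : ℝ) a (e w) : ℝ) : AddCircle (1 : ℝ)) = e w :=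
      AddCircle.coe_equivIco
    set r : ℝ := (AddCircle.equivIco (1 : ℝ) a (e w) : ℝ)
    have hne : r ≠ a := fun h => hw (e.injective (by rw [← h2, h, ha']))
    refine ⟨r - a, ⟨sub_pos.2 (lt_of_le_of_ne h1.1 hne.symm), by linarith [h1.2]⟩, ?_⟩
    simp [h2]
  · intro r hr s hs h
    by_contra hrs
    rw [not_lt] at hrs
    refine (sbtw_iff_not_btw.1 h) ?_
    rw [btw_cyclic, ← he, ← ha']
    simp only [e.apply_symm_apply]
    have : btw ((a : ℝ) : AddCircle (1 : ℝ)) ((a + s : ℝ) : AddCircle (1 : ℝ))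
        ((a + r : ℝ) : AddCircle (1 : ℝ)) := by
      refine QuotientAddGroup.btw_coe_iff.2 ?_
      rw [(toIcoMod_eq_self _).2 ⟨by linarith [hs.1], by linarith [hs.2]⟩,
        (toIocMod_eq_self _).2 ⟨by linarith [hr.1], by linarith [hr.2]⟩]
      linarith
    exact this

/-- A continuous injective function `t` on a circle minus a point is a homeomorphism onto an open
interval, and it is either monotone or antitone for the cyclic order. -/
lemma exists_inverse_of_injOn (e : X ≃ₜ AddCircle (1 : ℝ))
    (he : ∀ a b c : X, btw (e a) (e b) (e c) ↔ btw a b c) (x : X) {t : X → ℝ}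
    (ht : ContinuousOn t {x}ᶜ) (hinj : InjOn t {x}ᶜ) :
    ∃ (J : Set ℝ) (g : ℝ → X), IsOpen J ∧ J.OrdConnected ∧ ContinuousOn g J ∧
      (∀ s ∈ J, g s ≠ x ∧ t (g s) = s) ∧ (∀ w ≠ x, t w ∈ J ∧ g (t w) = w) ∧
      ((∀ w ≠ x, ∀ z ≠ x, sbtw x w z → t w < t z) ∨
        ∀ w ≠ x, ∀ z ≠ x, sbtw x w z → t z < t w) := by
  obtain ⟨q, hq, hbij, hord⟩ := exists_circle_coordinate e he x
  -- This treats the increasing case; the decreasing one is reduced to it by `r ↦ 1 - r`.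
  have aux : ∀ q' : ℝ → X, ContinuousOn q' (Ioo 0 1) → BijOn q' (Ioo 0 1) {x}ᶜ →
      StrictMonoOn (t ∘ q') (Ioo 0 1) → ∃ (J : Set ℝ) (g : ℝ → X), IsOpen J ∧ J.OrdConnected ∧
      ContinuousOn g J ∧ (∀ s ∈ J, g s ≠ x ∧ t (g s) = s) ∧ (∀ w ≠ x, t w ∈ J ∧ g (t w) = w) := by
    intro q' hq' hb hm
    have hcont : ContinuousOn (t ∘ q') (Ioo 0 1) := ht.comp hq' hb.mapsTo
    have hconn : ((t ∘ q') '' Ioo 0 1).OrdConnected :=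
      (isPreconnected_Ioo.image _ hcont).ordConnected
    -- The image is order connected, so its subspace topology is the order topology, and the inverse
    -- of an order isomorphism is continuous.
    let o := hm.orderIso (t ∘ q') (Ioo 0 1)
    have hoc : Continuous fun s => ((o.symm s : Ioo (0 : ℝ) 1) : ℝ) :=
      continuous_subtype_val.comp o.symm.continuous
    have hright : ∀ s (hs : s ∈ (t ∘ q') '' Ioo 0 1), t (q' (o.symm ⟨s, hs⟩)) = s := fun s hs =>
      congrArg Subtype.val (o.apply_symm_apply ⟨s, hs⟩)
    classical
    refine ⟨(t ∘ q') '' Ioo 0 1,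
      fun s => if hs : s ∈ (t ∘ q') '' Ioo 0 1 then q' (o.symm ⟨s, hs⟩) else x, ?_, hconn, ?_, ?_, ?_⟩
    · rw [isOpen_iff_mem_nhds]
      rintro _ ⟨r, hr, rfl⟩
      have h1 : r / 2 ∈ Ioo (0 : ℝ) 1 := ⟨by linarith [hr.1], by linarith [hr.1, hr.2]⟩
      have h2 : (r + 1) / 2 ∈ Ioo (0 : ℝ) 1 := ⟨by linarith [hr.1], by linarith [hr.1, hr.2]⟩
      refine mem_of_superset (Icc_mem_nhds (hm h1 hr (by linarith [hr.1]))
        (hm hr h2 (by linarith [hr.2]))) (hconn.out ⟨_, h1, rfl⟩ ⟨_, h2, rfl⟩)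
    · rw [continuousOn_iff_continuous_domRestrict]
      have h3 : Continuous fun s : (t ∘ q') '' Ioo 0 1 => q' (o.symm s) :=
        hq'.comp_continuous hoc fun s => (o.symm s).2
      convert h3 using 2 with s
      simp only [domRestrict_apply, dif_pos s.2]
    · intro s hs
      simp only [dif_pos hs]
      exact ⟨hb.mapsTo (o.symm ⟨s, hs⟩).2, hright s hs⟩
    · intro w hw
      obtain ⟨r, hr, rfl⟩ := hb.surjOn hw
      have hs : t (q' r) ∈ (t ∘ q') '' Ioo 0 1 := ⟨r, hr, rfl⟩
      refine ⟨hs, ?_⟩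
      simp only [dif_pos hs]
      exact hinj (hb.mapsTo (o.symm ⟨_, hs⟩).2) hw (hright _ hs)
  have hc : ContinuousOn (t ∘ q) (Ioo 0 1) := ht.comp hq hbij.mapsTo
  rcases hc.strictMonoOn_of_injOn_Ioo one_pos (hinj.comp hbij.injOn hbij.mapsTo) with hm | hm
  · obtain ⟨J, g, h1, h2, h3, h4, h5⟩ := aux q hq hbij hm
    refine ⟨J, g, h1, h2, h3, h4, h5, Or.inl fun w hw z hz h => ?_⟩
    obtain ⟨r, hr, rfl⟩ := hbij.surjOn hw
    obtain ⟨s, hs, rfl⟩ := hbij.surjOn hz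
    exact hm hr hs (hord r hr s hs h)
  · have hmaps : BijOn (fun r : ℝ => 1 - r) (Ioo 0 1) (Ioo 0 1) := by
      refine ⟨fun r hr => ⟨by linarith [hr.2], by linarith [hr.1]⟩, fun r _ s _ h => ?_,
        fun r hr => ⟨1 - r, ⟨by linarith [hr.2], by linarith [hr.1]⟩, by simp⟩⟩
      simpa using h
    obtain ⟨J, g, h1, h2, h3, h4, h5⟩ := aux (q ∘ fun r => 1 - r)
      (hq.comp (by fun_prop) hmaps.mapsTo) (hbij.comp hmaps) (fun r hr s hs hrs =>
        hm (hmaps.mapsTo hs) (hmaps.mapsTo hr) (by simpa using hrs))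
    refine ⟨J, g, h1, h2, h3, h4, h5, Or.inr fun w hw z hz h => ?_⟩
    obtain ⟨r, hr, rfl⟩ := hbij.surjOn hw
    obtain ⟨s, hs, rfl⟩ := hbij.surjOn hz
    exact hm hr hs (hord r hr s hs h)

end Circle

/-! ### Second differences, convexity and inflection -/

section Differences

/-- The determinant of the vectors `(u, t, 1)` at `a`, `b`, `c`; up to a positive factor, the second
divided difference of `u` if `a < b < c`. -/
def secondDiff (u : ℝ → ℝ) (a b c : ℝ) : ℝ := (c - b) * u a - (c - a) * u b + (b - a) * u c

/-- The determinant of the vectors `(u, v, 1, t)` at `a`, `b`, `c`, `d`. -/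
def planarDet (u v : ℝ → ℝ) (a b c d : ℝ) : ℝ :=
  (u a * v b - u b * v a) * (d - c) - (u a * v c - u c * v a) * (d - b) +
    (u a * v d - u d * v a) * (c - b) + (u b * v c - u c * v b) * (d - a) -
    (u b * v d - u d * v b) * (c - a) + (u c * v d - u d * v c) * (b - a)

variable {u v : ℝ → ℝ} {J : Set ℝ}

/-- Each cross difference of the quotients is a positive length times minus the same `4 × 4`
determinant, so a single sign makes the quotient strictly increasing in each of its three arguments.
-/
lemma secondDiff_div_lt {a b c d : ℝ} (hab : a < b) (hbc : b < c) (hcd : c < d)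
    (h1 : 0 < secondDiff v a b c) (h2 : 0 < secondDiff v a b d) (h3 : 0 < secondDiff v a c d)
    (h4 : 0 < secondDiff v b c d) (hD : planarDet u v a b c d < 0) :
    secondDiff u a b c / secondDiff v a b c < secondDiff u a b d / secondDiff v a b d ∧
    secondDiff u a b d / secondDiff v a b d < secondDiff u a c d / secondDiff v a c d ∧
    secondDiff u a c d / secondDiff v a c d < secondDiff u b c d / secondDiff v b c d := by
  have e1 : secondDiff u a b d * secondDiff v a b c - secondDiff u a b c * secondDiff v a b d =
      (b - a) * -planarDet u v a b c d := by
    simp only [secondDiff, planarDet]; ring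
  have e2 : secondDiff u a c d * secondDiff v a b d - secondDiff u a b d * secondDiff v a c d =
      (d - a) * -planarDet u v a b c d := by
    simp only [secondDiff, planarDet]; ring
  have e3 : secondDiff u b c d * secondDiff v a c d - secondDiff u a c d * secondDiff v b c d =
      (d - c) * -planarDet u v a b c d := by
    simp only [secondDiff, planarDet]; ring
  have hD' : 0 < -planarDet u v a b c d := by linarith
  refine ⟨(div_lt_div_iff₀ h1 h2).2 ?_, (div_lt_div_iff₀ h2 h3).2 ?_,
    (div_lt_div_iff₀ h3 h4).2 ?_⟩
  · have := mul_pos (sub_pos.2 hab) hD'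
    linarith
  · have := mul_pos (sub_pos.2 (hab.trans (hbc.trans hcd))) hD'
    linarith
  · have := mul_pos (sub_pos.2 hcd) hD'
    linarith

/-- The quotient `F` increases in every argument and tends to `0` on triples that collapse to `y`;
hence it is negative on triples before `y` and positive on triples after `y`. -/
lemma secondDiff_sign_of_pos (hJ : IsOpen J) (hJc : J.OrdConnected) {y : ℝ} (hy : y ∈ J)
    (hv : ∀ a ∈ J, ∀ b ∈ J, ∀ c ∈ J, a < b → b < c → 0 < secondDiff v a b c)
    (hD : ∀ a ∈ J, ∀ b ∈ J, ∀ c ∈ J, ∀ d ∈ J, a < b → b < c → c < d → planarDet u v a b c d < 0)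
    (hlim : ∀ δ > 0, ∃ η > 0, ∀ a ∈ J, ∀ b ∈ J, ∀ c ∈ J, a < b → b < c → y - η < a → c < y + η →
      |secondDiff u a b c / secondDiff v a b c| < δ) :
    (∀ a ∈ J, ∀ b ∈ J, ∀ c ∈ J, a < b → b < c → c ≤ y → secondDiff u a b c < 0) ∧
    (∀ a ∈ J, ∀ b ∈ J, ∀ c ∈ J, a < b → b < c → y ≤ a → 0 < secondDiff u a b c) := by
  set F : ℝ → ℝ → ℝ → ℝ := fun a b c => secondDiff u a b c / secondDiff v a b c with hF
  have hmono : ∀ a ∈ J, ∀ b ∈ J, ∀ c ∈ J, ∀ d ∈ J, a < b → b < c → c < d →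
      F a b c < F a b d ∧ F a b d < F a c d ∧ F a c d < F b c d :=
    fun a ha b hb c hc d hd hab hbc hcd => secondDiff_div_lt hab hbc hcd
      (hv a ha b hb c hc hab hbc) (hv a ha b hb d hd hab (hbc.trans hcd))
      (hv a ha c hc d hd (hab.trans hbc) hcd) (hv b hb c hc d hd hbc hcd)
      (hD a ha b hb c hc d hd hab hbc hcd)
  obtain ⟨ρ, hρ, hball⟩ := Metric.isOpen_iff.1 hJ y hy
  rw [Real.ball_eq_Ioo] at hball
  constructor
  · intro a ha b hb c hc hab hbc hcy
    have hby : b < y := hbc.trans_le hcy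
    suffices h : F a b y < 0 by
      have h1 : F a b c ≤ F a b y := by
        rcases hcy.eq_or_lt with rfl | hlt
        · exact le_rfl
        · exact (hmono a ha b hb c hc y hy hab hbc hlt).1.le
      by_contra hcon
      exact absurd (div_nonneg (not_lt.1 hcon) (hv a ha b hb c hc hab hbc).le)
        (not_le.2 (h1.trans_lt h))
    by_contra hcon
    -- Moving `b` to the midpoint makes the value strictly positive. Moving the first two points
    -- further towards `y`, beyond the midpoint and within `η` of `y`, only increases it, which
    -- contradicts the limit `0`.
    have hb' : (b + y) / 2 ∈ J := hJc.out hb hy ⟨by linarith, by linarith⟩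
    have h2 := (hmono a ha b hb _ hb' y hy hab (by linarith) (by linarith)).2.1
    obtain ⟨η, hη, hn⟩ := hlim (F a ((b + y) / 2) y) (by linarith)
    have hm : max ((b + y) / 2) (y - min η ρ) < y := by
      refine max_lt (by linarith) ?_
      linarith [lt_min hη hρ]
    set m := max ((b + y) / 2) (y - min η ρ) with hm'
    have hm1 : (b + y) / 2 ≤ m := le_max_left _ _
    have hm2 : y - min η ρ ≤ m := le_max_right _ _
    have hm3 : min η ρ ≤ η := min_le_left _ _
    have hp : m + (y - m) / 3 ∈ J := hJc.out hb hy ⟨by linarith, by linarith⟩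
    have hq : m + 2 * (y - m) / 3 ∈ J := hJc.out hb hy ⟨by linarith, by linarith⟩
    have h3 := (hmono a ha _ hb' _ hq y hy (by linarith) (by linarith) (by linarith)).2.1
    have h4 := (hmono a ha _ hp _ hq y hy (by linarith) (by linarith) (by linarith)).2.2
    have h5 := hn _ hp _ hq y hy (by linarith) (by linarith) (by linarith) (by linarith)
    have h6 := (le_abs_self _).trans_lt h5
    exact absurd (h3.trans h4) (not_lt.2 h6.le)
  · intro a ha b hb c hc hab hbc hya
    have hyb : y < b := hya.trans_lt hab
    suffices h : 0 < F y b c by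
      have h1 : F y b c ≤ F a b c := by
        rcases hya.eq_or_lt with rfl | hlt
        · exact le_rfl
        · exact (hmono y hy a ha b hb c hc hlt hab hbc).2.2.le
      by_contra hcon
      exact absurd (div_nonpos_of_nonpos_of_nonneg (not_lt.1 hcon) (hv a ha b hb c hc hab hbc).le)
        (not_le.2 (h.trans_le h1))
    by_contra hcon
    have hb' : (b + y) / 2 ∈ J := hJc.out hy hb ⟨by linarith, by linarith⟩
    have h2 := (hmono y hy _ hb' b hb c hc (by linarith) (by linarith) hbc).2.1
    obtain ⟨η, hη, hn⟩ := hlim (-F y ((b + y) / 2) c) (by linarith)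
    have hm : y < min ((b + y) / 2) (y + min η ρ) := by
      refine lt_min (by linarith) ?_
      linarith [lt_min hη hρ]
    set m := min ((b + y) / 2) (y + min η ρ) with hm'
    have hm1 : m ≤ (b + y) / 2 := min_le_left _ _
    have hm2 : m ≤ y + min η ρ := min_le_right _ _
    have hm3 : min η ρ ≤ η := min_le_left _ _
    have hp : y + (m - y) / 3 ∈ J := hJc.out hy hb ⟨by linarith, by linarith⟩
    have hq : y + 2 * (m - y) / 3 ∈ J := hJc.out hy hb ⟨by linarith, by linarith⟩
    have h3 := (hmono y hy _ hp _ hb' c hc (by linarith) (by linarith) (by linarith)).2.1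
    have h4 := (hmono y hy _ hp _ hq c hc (by linarith) (by linarith) (by linarith)).1
    have h5 := hn y hy _ hp _ hq (by linarith) (by linarith) (by linarith) (by linarith)
    have h6 := (neg_abs_le _).trans_lt (h4.trans h3)
    linarith

lemma pos_or_neg_of_ne_zero {α : Type*} [TopologicalSpace α] {S : Set α} (hS : IsPreconnected S)
    {F : α → ℝ} (hF : ContinuousOn F S) (h0 : ∀ x ∈ S, F x ≠ 0) :
    (∀ x ∈ S, 0 < F x) ∨ ∀ x ∈ S, F x < 0 := by
  by_contra! h
  obtain ⟨⟨a, ha, ha0⟩, b, hb, hb0⟩ := h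
  obtain ⟨z, hz, hz0⟩ := hS.intermediate_value ha hb hF ⟨ha0, hb0⟩
  exact h0 z hz hz0

/-- Increasing `k`-tuples of points of `J`. -/
def increasingTuples (k : ℕ) (J : Set ℝ) : Set (Fin k → ℝ) := {a | (∀ i, a i ∈ J) ∧ StrictMono a}

/-- Increasing tuples form a convex set; therefore a continuous function of them without zeros has
constant sign. -/
lemma isPreconnected_increasingTuples (k : ℕ) (hJ : J.OrdConnected) :
    IsPreconnected (increasingTuples k J) := by
  refine Convex.isPreconnected fun a ha b hb r s hr hs hrs => ⟨fun i => ?_, fun i j hij => ?_⟩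
  · exact hJ.convex (ha.1 i) (hb.1 i) hr hs hrs
  · have h1 := ha.2 hij
    have h2 := hb.2 hij
    simp only [Pi.add_apply, Pi.smul_apply, smul_eq_mul]
    rcases hr.eq_or_lt with rfl | hr'
    · simp only [zero_add] at hrs
      subst hrs
      linarith
    · exact add_lt_add_of_lt_of_le (mul_lt_mul_of_pos_left h1 hr')
        (mul_le_mul_of_nonneg_left h2.le hs)

lemma mem_increasingTuples_three {a b c : ℝ} (ha : a ∈ J) (hb : b ∈ J) (hc : c ∈ J) (hab : a < b)
    (hbc : b < c) : ![a, b, c] ∈ increasingTuples 3 J := by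
  refine ⟨fun i => by fin_cases i <;> assumption, Fin.strictMono_iff_lt_succ.2 fun i => ?_⟩
  fin_cases i <;> assumption

lemma mem_increasingTuples_four {a b c d : ℝ} (ha : a ∈ J) (hb : b ∈ J) (hc : c ∈ J) (hd : d ∈ J)
    (hab : a < b) (hbc : b < c) (hcd : c < d) : ![a, b, c, d] ∈ increasingTuples 4 J := by
  refine ⟨fun i => by fin_cases i <;> assumption, Fin.strictMono_iff_lt_succ.2 fun i => ?_⟩
  fin_cases i <;> assumption

lemma secondDiff_smul (r : ℝ) (a b c : ℝ) :
    secondDiff (fun s => r * u s) a b c = r * secondDiff u a b c := by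
  simp only [secondDiff]; ring

lemma planarDet_smul (r r' : ℝ) (a b c d : ℝ) :
    planarDet (fun s => r * u s) (fun s => r' * v s) a b c d = r * r' * planarDet u v a b c d := by
  simp only [planarDet]; ring

/-- If the curve `(u, v, t)` is in general position and the quotients of the second divided
differences of `u` and `v` tend to `0` at `y`, then `u` is strictly convex on one side of `y` and
strictly concave on the other side. -/
theorem secondDiff_sign (hJ : IsOpen J) (hJc : J.OrdConnected) {y : ℝ} (hy : y ∈ J)
    (hu : ContinuousOn u J) (hvc : ContinuousOn v J)
    (hv : ∀ a ∈ J, ∀ b ∈ J, ∀ c ∈ J, a < b → b < c → secondDiff v a b c ≠ 0)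
    (hD : ∀ a ∈ J, ∀ b ∈ J, ∀ c ∈ J, ∀ d ∈ J, a < b → b < c → c < d → planarDet u v a b c d ≠ 0)
    (hlim : ∀ δ > 0, ∃ η > 0, ∀ a ∈ J, ∀ b ∈ J, ∀ c ∈ J, a < b → b < c → y - η < a → c < y + η →
      |secondDiff u a b c / secondDiff v a b c| < δ) :
    ∃ r : ℝ, (r = 1 ∨ r = -1) ∧
    (∀ a ∈ J, ∀ b ∈ J, ∀ c ∈ J, a < b → b < c → c ≤ y → r * secondDiff u a b c < 0) ∧
    (∀ a ∈ J, ∀ b ∈ J, ∀ c ∈ J, a < b → b < c → y ≤ a → 0 < r * secondDiff u a b c) := by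
  have hcu : ∀ {k : ℕ} (i : Fin k), ContinuousOn (fun a : Fin k → ℝ => u (a i))
      (increasingTuples k J) := fun i =>
    hu.comp (continuous_apply i).continuousOn fun a ha => ha.1 i
  have hcv : ∀ {k : ℕ} (i : Fin k), ContinuousOn (fun a : Fin k → ℝ => v (a i))
      (increasingTuples k J) := fun i =>
    hvc.comp (continuous_apply i).continuousOn fun a ha => ha.1 i
  have hci : ∀ {k : ℕ} (i : Fin k), ContinuousOn (fun a : Fin k → ℝ => a i)
      (increasingTuples k J) := fun i => (continuous_apply i).continuousOn
  have sv : ∃ r' : ℝ, (r' = 1 ∨ r' = -1) ∧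
      ∀ a ∈ J, ∀ b ∈ J, ∀ c ∈ J, a < b → b < c → 0 < r' * secondDiff v a b c := by
    rcases pos_or_neg_of_ne_zero (isPreconnected_increasingTuples 3 hJc)
      (F := fun a => secondDiff v (a 0) (a 1) (a 2))
      (by
        simp only [secondDiff]
        exact ((((hci 2).sub (hci 1)).mul (hcv 0)).sub (((hci 2).sub (hci 0)).mul (hcv 1))).add
          (((hci 1).sub (hci 0)).mul (hcv 2)))
      (fun a ha => hv _ (ha.1 0) _ (ha.1 1) _ (ha.1 2) (ha.2 (by decide)) (ha.2 (by decide)))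
      with h | h
    · refine ⟨1, Or.inl rfl, fun a ha b hb c hc hab hbc => ?_⟩
      have := h _ (mem_increasingTuples_three ha hb hc hab hbc)
      simpa using this
    · refine ⟨-1, Or.inr rfl, fun a ha b hb c hc hab hbc => ?_⟩
      have := h _ (mem_increasingTuples_three ha hb hc hab hbc)
      simpa using this
  have sD : ∃ r : ℝ, (r = 1 ∨ r = -1) ∧ ∀ a ∈ J, ∀ b ∈ J, ∀ c ∈ J, ∀ d ∈ J,
      a < b → b < c → c < d → r * planarDet u v a b c d < 0 := by
    have hm : ∀ i j : Fin 4, ContinuousOn (fun a : Fin 4 → ℝ =>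
        u (a i) * v (a j) - u (a j) * v (a i)) (increasingTuples 4 J) := fun i j =>
      ((hcu i).mul (hcv j)).sub ((hcu j).mul (hcv i))
    have hs : ∀ i j : Fin 4, ContinuousOn (fun a : Fin 4 → ℝ => a i - a j)
        (increasingTuples 4 J) := fun i j => (hci i).sub (hci j)
    rcases pos_or_neg_of_ne_zero (isPreconnected_increasingTuples 4 hJc)
      (F := fun a => planarDet u v (a 0) (a 1) (a 2) (a 3))
      (by
        simp only [planarDet]
        exact ((((((hm 0 1).mul (hs 3 2)).sub ((hm 0 2).mul (hs 3 1))).add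
          ((hm 0 3).mul (hs 2 1))).add ((hm 1 2).mul (hs 3 0))).sub
          ((hm 1 3).mul (hs 2 0))).add ((hm 2 3).mul (hs 1 0)))
      (fun a ha => hD _ (ha.1 0) _ (ha.1 1) _ (ha.1 2) _ (ha.1 3) (ha.2 (by decide))
        (ha.2 (by decide)) (ha.2 (by decide)))
      with h | h
    · refine ⟨-1, Or.inr rfl, fun a ha b hb c hc d hd hab hbc hcd => ?_⟩
      have := h _ (mem_increasingTuples_four ha hb hc hd hab hbc hcd)
      simpa using this
    · refine ⟨1, Or.inl rfl, fun a ha b hb c hc d hd hab hbc hcd => ?_⟩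
      have := h _ (mem_increasingTuples_four ha hb hc hd hab hbc hcd)
      simpa using this
  obtain ⟨r', hr', hpos⟩ := sv
  obtain ⟨r, hr, hneg⟩ := sD
  have hr2 : r' * r' = 1 := by rcases hr' with rfl | rfl <;> norm_num
  have hrr : r' * r = 1 ∨ r' * r = -1 := by
    rcases hr' with rfl | rfl <;> rcases hr with rfl | rfl <;> norm_num
  have habs : |r| = 1 := by rcases hr with rfl | rfl <;> norm_num
  refine ⟨r' * r, hrr, ?_⟩
  -- The factor `r'` makes the second differences of `v` positive. With `u` scaled by `r' * r`, the
  -- determinant is scaled by `r' * r * r' = r` and becomes negative.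
  have := secondDiff_sign_of_pos (u := fun s => r' * r * u s) (v := fun s => r' * v s) hJ hJc hy
    (fun a ha b hb c hc hab hbc => by
      rw [secondDiff_smul]; exact hpos a ha b hb c hc hab hbc)
    (fun a ha b hb c hc d hd hab hbc hcd => by
      rw [planarDet_smul, show r' * r * r' = (r' * r') * r by ring, hr2, one_mul]
      exact hneg a ha b hb c hc d hd hab hbc hcd)
    (fun δ hδ => by
      obtain ⟨η, hη, h⟩ := hlim δ hδ
      refine ⟨η, hη, fun a ha b hb c hc hab hbc h1 h2 => ?_⟩
      have hne : r' ≠ 0 := fun h => by simp [h] at hr2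
      rw [secondDiff_smul, secondDiff_smul, mul_assoc, mul_div_mul_left _ _ hne, mul_div_assoc,
        abs_mul, habs, one_mul]
      exact h a ha b hb c hc hab hbc h1 h2)
  simpa only [secondDiff_smul] using this

/-- The graph of a strictly convex function stays strictly above its tangents. Convexity is needed
only on `J`, which will be a half-interval closed at the parameter of `y`. -/
lemma tangent_lt_of_secondDiff_pos (hJ : J.OrdConnected)
    (h : ∀ a ∈ J, ∀ b ∈ J, ∀ c ∈ J, a < b → b < c → 0 < secondDiff u a b c) {a s m : ℝ}
    (ha : a ∈ J) (hs : s ∈ J) (has : a ≠ s) (hm : HasDerivAt u m a) :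
    0 < u s - u a - m * (s - a) := by
  have hconv : StrictConvexOn ℝ J u := by
    refine strictConvexOn_of_slope_strict_mono_adjacent hJ.convex fun {p q r} hp hr hpq hqr => ?_
    have hq : q ∈ J := hJ.out hp hr ⟨hpq.le, hqr.le⟩
    have := h p hp q hq r hr hpq hqr
    rw [div_lt_div_iff₀ (sub_pos.2 hpq) (sub_pos.2 hqr)]
    simp only [secondDiff] at this
    linarith
  rcases has.lt_or_gt with hlt | hlt
  · have := hconv.lt_slope_of_hasDerivAt ha hs hlt hm
    rw [slope_def_field, lt_div_iff₀ (sub_pos.2 hlt)] at this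
    linarith
  · have := hconv.slope_lt_of_hasDerivAt hs ha hlt hm
    rw [slope_def_field, div_lt_iff₀ (sub_pos.2 hlt)] at this
    linarith

end Differences

/-! ### Consequences of general position -/

section GeneralPosition

variable {V : Type*} [NormedAddCommGroup V] [NormedSpace ℝ V] [FiniteDimensional ℝ V]
  {I : Type*} [TopologicalSpace I] {ξ : I → FullFlag V}

lemma IsHyperconvexFrenet.disjoint_iSup (h : IsHyperconvexFrenet ξ) {j : ℕ} {k : Fin j → ℕ}
    {w : Fin j → I} {x : I} {m : ℕ} (hk : m + ∑ l, k l ≤ Module.finrank ℝ V)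
    (hw : Function.Injective w) (hx : ∀ l, w l ≠ x) :
    Disjoint (⨆ l, (ξ (w l)).piece (k l)) ((ξ x).piece m) := by
  have h1 := h.general_position (j + 1) (Fin.cons m k) (Fin.cons x w)
    (by simpa [Fin.sum_univ_succ] using hk)
    (Fin.cons_injective_iff.2 ⟨fun ⟨l, hl⟩ => hx l hl, hw⟩)
  have h2 := (h1 0).symm
  refine h2.mono (iSup_le fun l => ?_) le_rfl
  exact le_iSup₂_of_le (f := fun (i : Fin (j + 1)) (_ : i ≠ 0) =>
    (ξ ((Fin.cons x w : Fin (j + 1) → I) i)).piece ((Fin.cons m k : Fin (j + 1) → ℕ) i))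
    l.succ (Fin.succ_ne_zero l) le_rfl

lemma IsHyperconvexFrenet.disjoint (h : IsHyperconvexFrenet ξ) {k m : ℕ} {w x : I} (hwx : w ≠ x)
    (hk : m + k ≤ Module.finrank ℝ V) : Disjoint ((ξ w).piece k) ((ξ x).piece m) := by
  have := h.disjoint_iSup (j := 1) (k := fun _ => k) (w := fun _ => w) (x := x) (m := m)
    (by simpa using hk) (fun _ _ _ => Subsingleton.elim _ _) fun _ => hwx
  simpa using this

lemma IsHyperconvexFrenet.linearIndependent (h : IsHyperconvexFrenet ξ) {j : ℕ} {w : Fin j → I}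
    (hj : j ≤ Module.finrank ℝ V) (hw : Function.Injective w) {z : Fin j → V}
    (hz : ∀ l, z l ∈ (ξ (w l)).piece 1) (hz0 : ∀ l, z l ≠ 0) : LinearIndependent ℝ z :=
  iSupIndep.linearIndependent _
    (h.general_position j (fun _ => 1) w (by simpa using hj) hw) hz hz0

end GeneralPosition

/-! ### Coordinates adapted to the flag at `x` and to the view point -/

section Coordinates

/-- The vectors are picked in `A₁`, in `p`, in `A₃` outside `A₂`, and outside `A₃`. Coefficients
decide membership of a combination in each subspace before independence is known; applied to the
zero vector, these criteria give independence. -/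
lemma exists_adapted_basis {V : Type*} [AddCommGroup V] [Module ℝ V] [FiniteDimensional ℝ V]
    (hV : Module.finrank ℝ V = 4) {A₁ A₂ A₃ p : Submodule ℝ V} (h12 : A₁ ≤ A₂) (h23 : A₂ < A₃)
    (h3 : A₃ < ⊤) (hp : p ≤ A₂) (hd : Disjoint A₁ p) (h1 : A₁ ≠ ⊥) (hp0 : p ≠ ⊥) :
    ∃ b : Module.Basis (Fin 4) ℝ V,
      (∀ z, z ∈ A₁ ↔ b.coord 1 z = 0 ∧ b.coord 2 z = 0 ∧ b.coord 3 z = 0) ∧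
      (∀ z, z ∈ A₂ ↔ b.coord 2 z = 0 ∧ b.coord 3 z = 0) ∧ (∀ z, z ∈ A₃ ↔ b.coord 3 z = 0) ∧
      ∀ z, z ∈ p ↔ b.coord 0 z = 0 ∧ b.coord 2 z = 0 ∧ b.coord 3 z = 0 := by
  obtain ⟨e0, he0, hne0⟩ := Submodule.exists_mem_ne_zero_of_ne_bot h1
  obtain ⟨e1, he1, hne1⟩ := Submodule.exists_mem_ne_zero_of_ne_bot hp0
  obtain ⟨e2, he2, hn2⟩ := SetLike.exists_of_lt h23
  obtain ⟨e3, -, hn3⟩ := SetLike.exists_of_lt h3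
  have k3 : ∀ a0 a1 a2 a3 : ℝ, a0 • e0 + a1 • e1 + a2 • e2 + a3 • e3 ∈ A₃ ↔ a3 = 0 := by
    intro a0 a1 a2 a3
    have hm : a0 • e0 + a1 • e1 + a2 • e2 ∈ A₃ := A₃.add_mem (A₃.add_mem
      (A₃.smul_mem _ (h23.le (h12 he0))) (A₃.smul_mem _ (h23.le (hp he1)))) (A₃.smul_mem _ he2)
    rw [A₃.add_mem_iff_right hm]
    refine ⟨fun h => by_contra fun h0 => hn3 ((A₃.smul_mem_iff h0).1 h), fun h => by simp [h]⟩
  have k2 : ∀ a0 a1 a2 a3 : ℝ, a0 • e0 + a1 • e1 + a2 • e2 + a3 • e3 ∈ A₂ ↔ a2 = 0 ∧ a3 = 0 := by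
    intro a0 a1 a2 a3
    have hm : a0 • e0 + a1 • e1 ∈ A₂ :=
      A₂.add_mem (A₂.smul_mem _ (h12 he0)) (A₂.smul_mem _ (hp he1))
    constructor
    · intro h
      obtain rfl := (k3 _ _ _ _).1 (h23.le h)
      rw [zero_smul, add_zero, A₂.add_mem_iff_right hm] at h
      exact ⟨by_contra fun h0 => hn2 ((A₂.smul_mem_iff h0).1 h), rfl⟩
    · rintro ⟨rfl, rfl⟩
      simpa using hm
  have k1 : ∀ a0 a1 a2 a3 : ℝ, a0 • e0 + a1 • e1 + a2 • e2 + a3 • e3 ∈ A₁ ↔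
      a1 = 0 ∧ a2 = 0 ∧ a3 = 0 := by
    intro a0 a1 a2 a3
    constructor
    · intro h
      obtain ⟨rfl, rfl⟩ := (k2 _ _ _ _).1 (h12 h)
      simp only [zero_smul, add_zero] at h
      rw [A₁.add_mem_iff_right (A₁.smul_mem _ he0)] at h
      have := Submodule.disjoint_def.1 hd _ h (p.smul_mem _ he1)
      exact ⟨(smul_eq_zero.1 this).resolve_right hne1, rfl, rfl⟩
    · rintro ⟨rfl, rfl, rfl⟩
      simpa using A₁.smul_mem _ he0
  have kp : ∀ a0 a1 a2 a3 : ℝ, a0 • e0 + a1 • e1 + a2 • e2 + a3 • e3 ∈ p ↔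
      a0 = 0 ∧ a2 = 0 ∧ a3 = 0 := by
    intro a0 a1 a2 a3
    constructor
    · intro h
      obtain ⟨rfl, rfl⟩ := (k2 _ _ _ _).1 (hp h)
      simp only [zero_smul, add_zero] at h
      rw [p.add_mem_iff_left (p.smul_mem _ he1)] at h
      have := Submodule.disjoint_def.1 hd _ (A₁.smul_mem _ he0) h
      exact ⟨(smul_eq_zero.1 this).resolve_right hne0, rfl, rfl⟩
    · rintro ⟨rfl, rfl, rfl⟩
      simpa using p.smul_mem _ he1
  have hli : LinearIndependent ℝ ![e0, e1, e2, e3] := by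
    rw [Fintype.linearIndependent_iff]
    intro a ha
    simp only [Fin.sum_univ_four, Matrix.cons_val] at ha
    have q1 := (k1 (a 0) (a 1) (a 2) (a 3)).1 (ha ▸ A₁.zero_mem)
    have q2 := (kp (a 0) (a 1) (a 2) (a 3)).1 (ha ▸ p.zero_mem)
    intro i
    fin_cases i
    exacts [q2.1, q1.1, q1.2.1, q1.2.2]
  let b := basisOfLinearIndependentOfCardEqFinrank hli (by simp [hV])
  have hb : ⇑b = ![e0, e1, e2, e3] := coe_basisOfLinearIndependentOfCardEqFinrank hli _
  have hz : ∀ z, z = b.coord 0 z • e0 + b.coord 1 z • e1 + b.coord 2 z • e2 + b.coord 3 z • e3 := by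
    intro z
    conv_lhs => rw [← b.sum_repr z]
    simp [Fin.sum_univ_four, hb]
  refine ⟨b, fun z => ?_, fun z => ?_, fun z => ?_, fun z => ?_⟩
  · conv_lhs => rw [hz z]
    exact k1 _ _ _ _
  · conv_lhs => rw [hz z]
    exact k2 _ _ _ _
  · conv_lhs => rw [hz z]
    exact k3 _ _ _ _
  · conv_lhs => rw [hz z]
    exact kp _ _ _ _

/-- A basis adapted to the flag `ξ(x)`, with second vector in `p_xy`. -/
structure IsFrontBasis {X : Type*} (ξ : X → FullFlag (Fin 4 → ℝ)) (x y : X)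
    (b : Module.Basis (Fin 4) ℝ (Fin 4 → ℝ)) : Prop where
  mem_one : ∀ z, z ∈ (ξ x).piece 1 ↔ b.coord 1 z = 0 ∧ b.coord 2 z = 0 ∧ b.coord 3 z = 0
  mem_two : ∀ z, z ∈ (ξ x).piece 2 ↔ b.coord 2 z = 0 ∧ b.coord 3 z = 0
  mem_three : ∀ z, z ∈ (ξ x).piece 3 ↔ b.coord 3 z = 0
  mem_viewPoint : ∀ z, z ∈ viewPoint ξ x y ↔
    b.coord 0 z = 0 ∧ b.coord 2 z = 0 ∧ b.coord 3 z = 0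

variable {X : Type*} {ξ : X → FullFlag (Fin 4 → ℝ)} {x y : X}

/-- Already `ξ²(x)` and `ξ²(y)` span everything, so the dimension is `2 + 3 - 4`. -/
lemma finrank_viewPoint [TopologicalSpace X] (hξ : IsHyperconvexFrenet ξ) (hxy : x ≠ y) :
    Module.finrank ℝ (viewPoint ξ x y) = 1 := by
  have hd := hξ.disjoint (k := 2) (m := 2) hxy (by simp)
  have h2 : (ξ x).piece 2 ⊔ (ξ y).piece 2 = ⊤ :=
    Submodule.eq_top_of_disjoint _ _ (by simp [FullFlag.finrank_piece]) hd
  have h3 : (ξ x).piece 2 ⊔ (ξ y).piece 3 = ⊤ :=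
    top_le_iff.1 (h2 ▸ sup_le_sup_left ((ξ y).mono (by norm_num)) _)
  have := Submodule.finrank_sup_add_finrank_inf_eq ((ξ x).piece 2) ((ξ y).piece 3)
  rw [h3] at this
  simp [FullFlag.finrank_piece] at this
  rw [viewPoint]
  omega

lemma finrank_viewPlane [TopologicalSpace X] (hξ : IsHyperconvexFrenet ξ) (hxy : x ≠ y) :
    Module.finrank ℝ (viewPlane ξ x y) = 3 := by
  have hd := hξ.disjoint (k := 2) (m := 1) hxy.symm (by simp)
  have := Submodule.finrank_sup_add_finrank_inf_eq ((ξ y).piece 2) ((ξ x).piece 1)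
  rw [hd.eq_bot, finrank_bot, FullFlag.finrank_piece, FullFlag.finrank_piece] at this
  rw [viewPlane]
  simpa using this

/-- Write a common point as `a + c` with `a` in `ξ²(y)` and `c` in `ξ¹(x)`. Lying in `ξ³(y)` forces
`c = 0`; lying in `ξ²(x)` then forces `a = 0`. -/
lemma isCompl_viewPlane [TopologicalSpace X] (hξ : IsHyperconvexFrenet ξ) (hxy : x ≠ y) :
    IsCompl (viewPlane ξ x y) (viewPoint ξ x y) := by
  have hd : Disjoint (viewPlane ξ x y) (viewPoint ξ x y) := by
    refine Submodule.disjoint_def.2 fun z hz hzp => ?_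
    obtain ⟨a, ha, c, hc, rfl⟩ := Submodule.mem_sup.1 hz
    have h1 : c ∈ (ξ y).piece 3 :=
      (((ξ y).piece 3).add_mem_iff_right ((ξ y).mono (by norm_num) ha)).1 hzp.2
    have h2 := Submodule.disjoint_def.1 (hξ.disjoint (k := 1) (m := 3) hxy (by simp)) c hc h1
    rw [h2, add_zero] at hzp ⊢
    exact Submodule.disjoint_def.1 (hξ.disjoint (k := 2) (m := 2) hxy (by simp)) a hzp.1 ha
  refine ⟨hd, codisjoint_iff.2 (Submodule.eq_top_of_disjoint _ _ ?_ hd)⟩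
  simp [finrank_viewPoint hξ hxy, finrank_viewPlane hξ hxy]

lemma exists_isFrontBasis [TopologicalSpace X] (hξ : IsHyperconvexFrenet ξ) (hxy : x ≠ y) :
    ∃ b, IsFrontBasis ξ x y b := by
  have hlt : ∀ {A B : Submodule ℝ (Fin 4 → ℝ)}, A ≤ B →
      Module.finrank ℝ A < Module.finrank ℝ B → A < B := fun h h' =>
    h.lt_of_ne fun he => lt_irrefl _ (he ▸ h')
  obtain ⟨b, h1, h2, h3, h4⟩ := exists_adapted_basis (V := Fin 4 → ℝ) (by simp)
    (A₁ := (ξ x).piece 1) (A₂ := (ξ x).piece 2) (A₃ := (ξ x).piece 3) (p := viewPoint ξ x y)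
    ((ξ x).mono (by norm_num))
    (hlt ((ξ x).mono (by norm_num)) (by simp [FullFlag.finrank_piece]))
    (hlt le_top (by simp [FullFlag.finrank_piece])) inf_le_left
    ((hξ.disjoint (k := 1) (m := 3) hxy (by simp)).mono le_rfl inf_le_right)
    (fun h => by
      have := (ξ x).finrank_piece 1
      rw [h, finrank_bot] at this
      simp at this)
    (fun h => by
      have := finrank_viewPoint hξ hxy
      rw [h, finrank_bot] at this
      simp at this)
  exact ⟨b, h1, h2, h3, h4⟩

/-- The map given by the coordinates with indices `i l`. -/
noncomputable def coordMap (b : Module.Basis (Fin 4) ℝ (Fin 4 → ℝ)) {k : ℕ} (i : Fin k → Fin 4) :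
    (Fin 4 → ℝ) →L[ℝ] Fin k → ℝ :=
  ContinuousLinearMap.pi fun l => LinearMap.toContinuousLinearMap (b.coord (i l))

@[simp] lemma coordMap_apply (b : Module.Basis (Fin 4) ℝ (Fin 4 → ℝ)) {k : ℕ} (i : Fin k → Fin 4)
    (z : Fin 4 → ℝ) (l : Fin k) : coordMap b i z l = b.coord (i l) z := rfl

variable {b : Module.Basis (Fin 4) ℝ (Fin 4 → ℝ)}

namespace IsFrontBasis

lemma ker_one (hb : IsFrontBasis ξ x y b) :
    LinearMap.ker (coordMap b ![3] : (Fin 4 → ℝ) →ₗ[ℝ] Fin 1 → ℝ) = (ξ x).piece 3 := by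
  ext z
  rw [hb.mem_three, LinearMap.mem_ker, funext_iff]
  simp

lemma ker_two (hb : IsFrontBasis ξ x y b) :
    LinearMap.ker (coordMap b ![2, 3] : (Fin 4 → ℝ) →ₗ[ℝ] Fin 2 → ℝ) = (ξ x).piece 2 := by
  ext z
  rw [hb.mem_two, LinearMap.mem_ker, funext_iff]
  simp [Fin.forall_fin_two]

lemma ker_three (hb : IsFrontBasis ξ x y b) :
    LinearMap.ker (coordMap b ![1, 2, 3] : (Fin 4 → ℝ) →ₗ[ℝ] Fin 3 → ℝ) = (ξ x).piece 1 := by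
  ext z
  rw [hb.mem_one, LinearMap.mem_ker, funext_iff]
  simp [Fin.forall_fin_succ]

end IsFrontBasis

lemma coord_ext {z z' : Fin 4 → ℝ} (h0 : b.coord 0 z = b.coord 0 z')
    (h1 : b.coord 1 z = b.coord 1 z') (h2 : b.coord 2 z = b.coord 2 z')
    (h3 : b.coord 3 z = b.coord 3 z') : z = z' := by
  refine b.ext_elem fun i => ?_
  fin_cases i
  exacts [h0, h1, h2, h3]

end Coordinates

/-! ### The curve and its tangents in the affine chart -/

section AffineLift

variable {X : Type*} [TopologicalSpace X] {ξ : X → FullFlag (Fin 4 → ℝ)} {x y : X}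
  {b : Module.Basis (Fin 4) ℝ (Fin 4 → ℝ)}

/-- The point of `ξ¹(w)` with last coordinate `1`. -/
noncomputable def affineLift (ξ : X → FullFlag (Fin 4 → ℝ))
    (b : Module.Basis (Fin 4) ℝ (Fin 4 → ℝ)) (w : X) : Fin 4 → ℝ :=
  chartSection (coordMap b ![3] : (Fin 4 → ℝ) →ₗ[ℝ] Fin 1 → ℝ) ![1] ((ξ w).piece 1)

/-- The point of `ξ²(w)` with last coordinates `1`, `0`. -/
noncomputable def tangentLift (ξ : X → FullFlag (Fin 4 → ℝ))
    (b : Module.Basis (Fin 4) ℝ (Fin 4 → ℝ)) (w : X) : Fin 4 → ℝ :=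
  chartSection (coordMap b ![2, 3] : (Fin 4 → ℝ) →ₗ[ℝ] Fin 2 → ℝ) ![1, 0] ((ξ w).piece 2)

lemma piece_one_mem_chartDomain (hξ : IsHyperconvexFrenet ξ) (hb : IsFrontBasis ξ x y b) {w : X}
    (hw : w ≠ x) : (ξ w).piece 1 ∈ chartDomain (coordMap b ![3]) :=
  ⟨by simp [FullFlag.finrank_piece], hb.ker_one ▸ hξ.disjoint hw (by simp)⟩

lemma piece_two_mem_chartDomain (hξ : IsHyperconvexFrenet ξ) (hb : IsFrontBasis ξ x y b) {w : X}
    (hw : w ≠ x) : (ξ w).piece 2 ∈ chartDomain (coordMap b ![2, 3]) :=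
  ⟨by simp [FullFlag.finrank_piece], hb.ker_two ▸ hξ.disjoint hw (by simp)⟩

lemma piece_three_mem_chartDomain (hξ : IsHyperconvexFrenet ξ) (hb : IsFrontBasis ξ x y b) {w : X}
    (hw : w ≠ x) : (ξ w).piece 3 ∈ chartDomain (coordMap b ![1, 2, 3]) :=
  ⟨by simp [FullFlag.finrank_piece], hb.ker_three ▸ hξ.disjoint hw (by simp)⟩

lemma affineLift_mem (hξ : IsHyperconvexFrenet ξ) (hb : IsFrontBasis ξ x y b) {w : X}
    (hw : w ≠ x) : affineLift ξ b w ∈ (ξ w).piece 1 :=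
  (chartSection_spec (piece_one_mem_chartDomain hξ hb hw).1
    (piece_one_mem_chartDomain hξ hb hw).2 _).1

lemma coord_three_affineLift (hξ : IsHyperconvexFrenet ξ) (hb : IsFrontBasis ξ x y b) {w : X}
    (hw : w ≠ x) : b.coord 3 (affineLift ξ b w) = 1 :=
  congrFun (chartSection_spec (piece_one_mem_chartDomain hξ hb hw).1
    (piece_one_mem_chartDomain hξ hb hw).2 ![1]).2 0

lemma tangentLift_mem (hξ : IsHyperconvexFrenet ξ) (hb : IsFrontBasis ξ x y b) {w : X}
    (hw : w ≠ x) : tangentLift ξ b w ∈ (ξ w).piece 2 :=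
  (chartSection_spec (piece_two_mem_chartDomain hξ hb hw).1
    (piece_two_mem_chartDomain hξ hb hw).2 _).1

lemma coord_two_tangentLift (hξ : IsHyperconvexFrenet ξ) (hb : IsFrontBasis ξ x y b) {w : X}
    (hw : w ≠ x) : b.coord 2 (tangentLift ξ b w) = 1 :=
  congrFun (chartSection_spec (piece_two_mem_chartDomain hξ hb hw).1
    (piece_two_mem_chartDomain hξ hb hw).2 ![1, 0]).2 0

lemma coord_three_tangentLift (hξ : IsHyperconvexFrenet ξ) (hb : IsFrontBasis ξ x y b) {w : X}
    (hw : w ≠ x) : b.coord 3 (tangentLift ξ b w) = 0 :=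
  congrFun (chartSection_spec (piece_two_mem_chartDomain hξ hb hw).1
    (piece_two_mem_chartDomain hξ hb hw).2 ![1, 0]).2 1

lemma affineLift_ne_zero (hξ : IsHyperconvexFrenet ξ) (hb : IsFrontBasis ξ x y b) {w : X}
    (hw : w ≠ x) : affineLift ξ b w ≠ 0 := fun h => by
  simpa [h] using coord_three_affineLift hξ hb hw

lemma span_affineLift (hξ : IsHyperconvexFrenet ξ) (hb : IsFrontBasis ξ x y b) {w : X}
    (hw : w ≠ x) : Submodule.span ℝ {affineLift ξ b w} = (ξ w).piece 1 :=
  Submodule.eq_of_le_of_finrank_eq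
    ((Submodule.span_singleton_le_iff_mem _ _).2 (affineLift_mem hξ hb hw))
    (by rw [finrank_span_singleton (affineLift_ne_zero hξ hb hw)]; simp [FullFlag.finrank_piece])

lemma span_affineLift_tangentLift (hξ : IsHyperconvexFrenet ξ) (hb : IsFrontBasis ξ x y b) {w : X}
    (hw : w ≠ x) :
    Submodule.span ℝ {affineLift ξ b w, tangentLift ξ b w} = (ξ w).piece 2 := by
  have h1 : affineLift ξ b w ∈ (ξ w).piece 2 :=
    (ξ w).mono (by norm_num) (affineLift_mem hξ hb hw)
  have h2 := tangentLift_mem hξ hb hw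
  refine le_antisymm (Submodule.span_le.2 ?_) fun z hz => ?_
  · rintro z (rfl | rfl)
    exacts [h1, h2]
  · set r := b.coord 3 z
    set s := b.coord 2 z - r * b.coord 2 (affineLift ξ b w)
    have hd := Submodule.disjoint_def.1 (hξ.disjoint (k := 2) (m := 2) hw (by simp))
      (z - (r • affineLift ξ b w + s • tangentLift ξ b w))
      (Submodule.sub_mem _ hz (Submodule.add_mem _ (Submodule.smul_mem _ _ h1)
        (Submodule.smul_mem _ _ h2)))
      ((hb.mem_two _).2 ⟨by
        simp only [map_sub, map_add, map_smul, coord_two_tangentLift hξ hb hw, smul_eq_mul, s]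
        ring, by
        simp only [map_sub, map_add, map_smul, coord_three_tangentLift hξ hb hw,
          coord_three_affineLift hξ hb hw, smul_eq_mul, r]
        ring⟩)
    exact Submodule.mem_span_pair.2 ⟨r, s, (sub_eq_zero.1 hd).symm⟩

lemma continuousOn_affineLift (hξ : IsHyperconvexFrenet ξ) (hb : IsFrontBasis ξ x y b) :
    ContinuousOn (affineLift ξ b) {x}ᶜ := fun _ hw =>
  (ContinuousAt.comp (g := chartSection _ _) (continuousAt_chartSection _ (piece_one_mem_chartDomain hξ hb hw))
    (f := fun w => (ξ w).piece 1)
    (hξ.continuous_piece 1).continuousAt).continuousWithinAt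

lemma continuousOn_tangentLift (hξ : IsHyperconvexFrenet ξ) (hb : IsFrontBasis ξ x y b) :
    ContinuousOn (tangentLift ξ b) {x}ᶜ := fun _ hw =>
  (ContinuousAt.comp (g := chartSection _ _) (continuousAt_chartSection _ (piece_two_mem_chartDomain hξ hb hw))
    (f := fun w => (ξ w).piece 2)
    (hξ.continuous_piece 2).continuousAt).continuousWithinAt

/-- Two points with equal coordinate differ by a vector of `ξ²(x)`, which is transverse to the span
of the two points. -/
lemma injOn_coord_two_affineLift (hξ : IsHyperconvexFrenet ξ) (hb : IsFrontBasis ξ x y b) :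
    InjOn (fun w => b.coord 2 (affineLift ξ b w)) {x}ᶜ := by
  intro w hw w' hw' h
  by_contra hne
  have hinj : Function.Injective ![w, w'] := by
    intro i j hij
    fin_cases i <;> fin_cases j <;> simp_all [eq_comm]
  have hli := hξ.linearIndependent (j := 2) (w := ![w, w'])
    (z := ![affineLift ξ b w, affineLift ξ b w']) (by simp) hinj
    (Fin.forall_fin_two.2 ⟨affineLift_mem hξ hb hw, affineLift_mem hξ hb hw'⟩)
    (Fin.forall_fin_two.2 ⟨affineLift_ne_zero hξ hb hw, affineLift_ne_zero hξ hb hw'⟩)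
  have hd := hξ.disjoint_iSup (j := 2) (k := fun _ => 1) (w := ![w, w']) (x := x) (m := 2)
    (by simp) hinj (Fin.forall_fin_two.2 ⟨hw, hw'⟩)
  have h0 := Submodule.disjoint_def.1 hd (affineLift ξ b w - affineLift ξ b w')
    (Submodule.sub_mem _ (Submodule.mem_iSup_of_mem 0 (affineLift_mem hξ hb hw))
      (Submodule.mem_iSup_of_mem 1 (affineLift_mem hξ hb hw')))
    ((hb.mem_two _).2 ⟨by rw [map_sub]; exact sub_eq_zero.2 h, by
      rw [map_sub, coord_three_affineLift hξ hb hw, coord_three_affineLift hξ hb hw', sub_self]⟩)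
  have := LinearIndependent.pair_iff.1 hli 1 (-1) (by rw [← h0]; module)
  simp at this

end AffineLift

/-! ### The curve parametrized by the coordinate `t` -/

section Parametrization

variable {X : Type*} {ξ : X → FullFlag (Fin 4 → ℝ)} {x y : X}
  {b : Module.Basis (Fin 4) ℝ (Fin 4 → ℝ)}

/-- `g` parametrizes the circle minus `x` by the third coordinate, with values in the open interval
`J`. -/
structure IsFrontParam [TopologicalSpace X] (ξ : X → FullFlag (Fin 4 → ℝ)) (x : X)
    (b : Module.Basis (Fin 4) ℝ (Fin 4 → ℝ)) (J : Set ℝ) (g : ℝ → X) : Prop where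
  isOpen : IsOpen J
  ordConnected : J.OrdConnected
  continuousOn : ContinuousOn g J
  ne : ∀ s ∈ J, g s ≠ x
  coord : ∀ s ∈ J, b.coord 2 (affineLift ξ b (g s)) = s
  mem : ∀ w ≠ x, b.coord 2 (affineLift ξ b w) ∈ J
  inv : ∀ w ≠ x, g (b.coord 2 (affineLift ξ b w)) = w

lemma injective_pair {α : Type*} {a c : α} (h : a ≠ c) : Function.Injective ![a, c] := by
  intro i j hij
  fin_cases i <;> fin_cases j <;> simp_all [eq_comm]

/-- The `i`-th coordinate of the curve. -/
noncomputable def height (ξ : X → FullFlag (Fin 4 → ℝ)) (b : Module.Basis (Fin 4) ℝ (Fin 4 → ℝ))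
    (g : ℝ → X) (i : Fin 4) (s : ℝ) : ℝ := b.coord i (affineLift ξ b (g s))

/-- The combination of three points of the curve whose last two coordinates vanish. -/
noncomputable def tripleComb (ξ : X → FullFlag (Fin 4 → ℝ))
    (b : Module.Basis (Fin 4) ℝ (Fin 4 → ℝ)) (g : ℝ → X) (r s t : ℝ) : Fin 4 → ℝ :=
  (t - s) • affineLift ξ b (g r) - (t - r) • affineLift ξ b (g s) + (s - r) • affineLift ξ b (g t)

lemma coord_tripleComb {g : ℝ → X} (i : Fin 4) (r s t : ℝ) :
    b.coord i (tripleComb ξ b g r s t) = secondDiff (height ξ b g i) r s t := by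
  simp only [tripleComb, map_add, map_sub, map_smul, smul_eq_mul, secondDiff, height]

variable [TopologicalSpace X] {J : Set ℝ} {g : ℝ → X}

namespace IsFrontParam

lemma injOn (hg : IsFrontParam ξ x b J g) : InjOn g J := fun s hs r hr h => by
  rw [← hg.coord s hs, h, hg.coord r hr]

lemma continuousAt (hg : IsFrontParam ξ x b J g) {s : ℝ} (hs : s ∈ J) : ContinuousAt g s :=
  hg.continuousOn.continuousAt (hg.isOpen.mem_nhds hs)

/-- The secant quotient is the vector of `ξ¹(g r) ⊕ ξ¹(g s)` with last coordinates `1, 0`. This sum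
tends to `ξ²(g s)` as `r → s`, and the chart section is continuous. -/
theorem hasDerivAt (hg : IsFrontParam ξ x b J g) (hξ : IsHyperconvexFrenet ξ)
    (hb : IsFrontBasis ξ x y b) {s : ℝ} (hs : s ∈ J) :
    HasDerivAt (fun r => affineLift ξ b (g r)) (tangentLift ξ b (g s)) s := by
  rw [hasDerivAt_iff_tendsto_slope]
  have hev : ∀ᶠ r in 𝓝[≠] s, r ∈ J ∧ r ≠ s :=
    Filter.Eventually.and (mem_nhdsWithin_of_mem_nhds (hg.isOpen.mem_nhds hs)) self_mem_nhdsWithin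
  have hinj : ∀ r ∈ J, r ≠ s → Function.Injective ![g r, g s] := fun r hr hrs =>
    injective_pair fun h => hrs (hg.injOn hr hs h)
  have hlim := hξ.tendsto (l := 𝓝[≠] s) ![1, 1] (x := g s) (u := fun r => ![g r, g s]) (by simp)
    (hev.mono fun r hr => hinj r hr.1 hr.2)
    (Fin.forall_fin_two.2 ⟨(hg.continuousAt hs).mono_left nhdsWithin_le_nhds, tendsto_const_nhds⟩)
  have h2 : ∑ i, ![1, 1] i = 2 := rfl
  rw [h2] at hlim
  refine ((continuousAt_chartSection ![1, 0]
    (piece_two_mem_chartDomain hξ hb (hg.ne s hs))).tendsto.comp hlim).congr' ?_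
  filter_upwards [hev] with r hr
  refine chartSection_eq ?_ ?_ ?_
  · rw [hb.ker_two]
    exact hξ.disjoint_iSup (by simp [h2]) (hinj r hr.1 hr.2)
      (Fin.forall_fin_two.2 ⟨hg.ne r hr.1, hg.ne s hs⟩)
  · exact Submodule.smul_mem _ _ (Submodule.sub_mem _
      (Submodule.mem_iSup_of_mem 0 (affineLift_mem hξ hb (hg.ne r hr.1)))
      (Submodule.mem_iSup_of_mem 1 (affineLift_mem hξ hb (hg.ne s hs))))
  · have : r - s ≠ 0 := sub_ne_zero.2 hr.2
    refine funext (Fin.forall_fin_two.2 ⟨?_, ?_⟩)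
    · change b.coord 2 ((r - s)⁻¹ • (affineLift ξ b (g r) - affineLift ξ b (g s))) = 1
      rw [map_smul, map_sub, hg.coord r hr.1, hg.coord s hs, smul_eq_mul, inv_mul_cancel₀ this]
    · change b.coord 3 ((r - s)⁻¹ • (affineLift ξ b (g r) - affineLift ξ b (g s))) = 0
      rw [map_smul, map_sub, coord_three_affineLift hξ hb (hg.ne r hr.1),
        coord_three_affineLift hξ hb (hg.ne s hs), sub_self, smul_zero]

lemma contDiffOn (hg : IsFrontParam ξ x b J g) (hξ : IsHyperconvexFrenet ξ)
    (hb : IsFrontBasis ξ x y b) : ContDiffOn ℝ 1 (fun r => affineLift ξ b (g r)) J := by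
  rw [show (1 : WithTop ℕ∞) = 0 + 1 by simp, contDiffOn_succ_iff_deriv_of_isOpen hg.isOpen]
  refine ⟨fun s hs => (hg.hasDerivAt hξ hb hs).differentiableAt.differentiableWithinAt,
    by simp, ?_⟩
  rw [contDiffOn_zero]
  exact ((continuousOn_tangentLift hξ hb).comp hg.continuousOn hg.ne).congr
    fun s hs => (hg.hasDerivAt hξ hb hs).deriv

lemma continuousOn_height (hg : IsFrontParam ξ x b J g) (hξ : IsHyperconvexFrenet ξ)
    (hb : IsFrontBasis ξ x y b) (i : Fin 4) : ContinuousOn (height ξ b g i) J :=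
  (LinearMap.continuous_of_finiteDimensional (b.coord i)).comp_continuousOn
    ((continuousOn_affineLift hξ hb).comp hg.continuousOn hg.ne)

lemma hasDerivAt_height (hg : IsFrontParam ξ x b J g) (hξ : IsHyperconvexFrenet ξ)
    (hb : IsFrontBasis ξ x y b) {s : ℝ} (hs : s ∈ J) (i : Fin 4) :
    HasDerivAt (height ξ b g i) (b.coord i (tangentLift ξ b (g s))) s :=
  (LinearMap.toContinuousLinearMap (b.coord i)).hasFDerivAt.comp_hasDerivAt s
    (hg.hasDerivAt hξ hb hs)

lemma coord_two_tripleComb (hg : IsFrontParam ξ x b J g) {r s t : ℝ} (hr : r ∈ J) (hs : s ∈ J)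
    (ht : t ∈ J) : b.coord 2 (tripleComb ξ b g r s t) = 0 := by
  simp only [tripleComb, map_add, map_sub, map_smul, smul_eq_mul, hg.coord r hr, hg.coord s hs,
    hg.coord t ht]
  ring

lemma coord_three_tripleComb (hg : IsFrontParam ξ x b J g) (hξ : IsHyperconvexFrenet ξ)
    (hb : IsFrontBasis ξ x y b) {r s t : ℝ} (hr : r ∈ J) (hs : s ∈ J)
    (ht : t ∈ J) : b.coord 3 (tripleComb ξ b g r s t) = 0 := by
  simp only [tripleComb, map_add, map_sub, map_smul, smul_eq_mul,
    coord_three_affineLift hξ hb (hg.ne r hr), coord_three_affineLift hξ hb (hg.ne s hs),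
    coord_three_affineLift hξ hb (hg.ne t ht)]
  ring

lemma injective_comp (hg : IsFrontParam ξ x b J g) {k : ℕ} {a : Fin k → ℝ}
    (ha : a ∈ increasingTuples k J) : Function.Injective fun i => g (a i) := fun i j h =>
  ha.2.injective (hg.injOn (ha.1 i) (ha.1 j) h)

/-- Otherwise `tripleComb` lies in `ξ¹(x)`, which is transverse to the span of the three points, and
is thus a nontrivial relation between them. -/
lemma secondDiff_ne_zero (hg : IsFrontParam ξ x b J g) (hξ : IsHyperconvexFrenet ξ)
    (hb : IsFrontBasis ξ x y b) {r s t : ℝ} (hr : r ∈ J) (hs : s ∈ J)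
    (ht : t ∈ J) (hrs : r < s) (hst : s < t) : secondDiff (height ξ b g 1) r s t ≠ 0 := by
  intro h0
  have hmem := mem_increasingTuples_three hr hs ht hrs hst
  have hd := hξ.disjoint_iSup (k := fun _ => 1) (w := fun i => g (![r, s, t] i)) (x := x) (m := 1)
    (by simp) (hg.injective_comp hmem) (fun i => hg.ne _ (hmem.1 i))
  have hli := hξ.linearIndependent (w := fun i => g (![r, s, t] i))
    (z := fun i => affineLift ξ b (g (![r, s, t] i))) (by simp) (hg.injective_comp hmem)
    (fun i => affineLift_mem hξ hb (hg.ne _ (hmem.1 i)))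
    (fun i => affineLift_ne_zero hξ hb (hg.ne _ (hmem.1 i)))
  have hz : tripleComb ξ b g r s t = 0 := by
    refine Submodule.disjoint_def.1 hd _ ?_ ((hb.mem_one _).2 ⟨?_, hg.coord_two_tripleComb hr hs ht,
      hg.coord_three_tripleComb hξ hb hr hs ht⟩)
    · exact Submodule.add_mem _ (Submodule.sub_mem _
        (Submodule.smul_mem _ _ (Submodule.mem_iSup_of_mem 0 (affineLift_mem hξ hb (hg.ne r hr))))
        (Submodule.smul_mem _ _ (Submodule.mem_iSup_of_mem 1 (affineLift_mem hξ hb (hg.ne s hs)))))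
        (Submodule.smul_mem _ _ (Submodule.mem_iSup_of_mem 2 (affineLift_mem hξ hb (hg.ne t ht))))
    · rw [coord_tripleComb, h0]
  have := Fintype.linearIndependent_iff.1 hli ![t - s, -(t - r), s - r]
    (by
      rw [← hz, tripleComb]
      simp only [Fin.sum_univ_three, Matrix.cons_val]
      module) 2
  simp only [Matrix.cons_val] at this
  linarith

/-- Eliminating coordinate `1` between two triple combinations that share `r, s` leaves a vector
whose only possibly nonzero coordinate is `(s - r)` times the determinant. If that vanishes, the
four points satisfy a relation with last coefficient `-A * (s - r) ≠ 0`. -/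
lemma planarDet_ne_zero (hg : IsFrontParam ξ x b J g) (hξ : IsHyperconvexFrenet ξ)
    (hb : IsFrontBasis ξ x y b) {r s t q : ℝ} (hr : r ∈ J) (hs : s ∈ J) (ht : t ∈ J) (hq : q ∈ J)
    (hrs : r < s) (hst : s < t) (htq : t < q) :
    planarDet (height ξ b g 0) (height ξ b g 1) r s t q ≠ 0 := by
  intro h0
  have hmem := mem_increasingTuples_four hr hs ht hq hrs hst htq
  have hli := hξ.linearIndependent (w := fun i => g (![r, s, t, q] i))
    (z := fun i => affineLift ξ b (g (![r, s, t, q] i))) (by simp) (hg.injective_comp hmem)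
    (fun i => affineLift_mem hξ hb (hg.ne _ (hmem.1 i)))
    (fun i => affineLift_ne_zero hξ hb (hg.ne _ (hmem.1 i)))
  set A := secondDiff (height ξ b g 1) r s t with hA
  set B := secondDiff (height ξ b g 1) r s q with hB
  have hz : B • tripleComb ξ b g r s t - A • tripleComb ξ b g r s q = 0 := by
    refine coord_ext (b := b) ?_ ?_ ?_ ?_ <;>
      simp only [map_sub, map_smul, map_zero, smul_eq_mul, hg.coord_two_tripleComb hr hs ht,
        hg.coord_two_tripleComb hr hs hq, hg.coord_three_tripleComb hξ hb hr hs ht,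
        hg.coord_three_tripleComb hξ hb hr hs hq, coord_tripleComb, ← hA, ← hB]
    · have : B * secondDiff (height ξ b g 0) r s t - A * secondDiff (height ξ b g 0) r s q =
        (s - r) * planarDet (height ξ b g 0) (height ξ b g 1) r s t q := by
        simp only [hA, hB, secondDiff, planarDet]; ring
      rw [this, h0, mul_zero]
    · ring
    · ring
    · ring
  have := Fintype.linearIndependent_iff.1 hli
    ![B * (t - s) - A * (q - s), A * (q - r) - B * (t - r), B * (s - r),
      -A * (s - r)]
    (by
      rw [← hz, tripleComb, tripleComb]
      simp only [Fin.sum_univ_four, Matrix.cons_val]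
      module) 3
  simp only [Matrix.cons_val] at this
  exact mul_ne_zero (neg_ne_zero.2 (hg.secondDiff_ne_zero hξ hb hr hs ht hrs hst))
    (sub_pos.2 hrs).ne' this

/-- The position of `p_xy` inside `ξ³(y)` enters here. The quotient is coordinate `0` of the vector
with coordinates `1, 0, 0` in places `1, 2, 3` in the span of three points; this span tends to
`ξ³(y)`, where that vector is `b 1`, a vector of `p_xy`. -/
lemma tendsto_secondDiff_div (hg : IsFrontParam ξ x b J g) (hξ : IsHyperconvexFrenet ξ)
    (hb : IsFrontBasis ξ x y b) {c : ℝ} (hc : c ∈ J) (hgc : g c = y) :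
    Tendsto (fun a : Fin 3 → ℝ => secondDiff (height ξ b g 0) (a 0) (a 1) (a 2) /
      secondDiff (height ξ b g 1) (a 0) (a 1) (a 2))
      (𝓝 (fun _ => c) ⊓ 𝓟 (increasingTuples 3 J)) (𝓝 0) := by
  have hev : ∀ᶠ a in 𝓝 (fun _ => c) ⊓ 𝓟 (increasingTuples 3 J), a ∈ increasingTuples 3 J :=
    eventually_inf_principal.2 (Eventually.of_forall fun _ h => h)
  have hy : y ≠ x := hgc ▸ hg.ne c hc
  have hlim := hξ.tendsto (l := 𝓝 (fun _ => c) ⊓ 𝓟 (increasingTuples 3 J)) (fun _ : Fin 3 => 1)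
    (x := y) (u := fun a i => g (a i)) (by simp) (hev.mono fun a ha => hg.injective_comp ha)
    (fun i => by
      have h1 : Tendsto (fun a : Fin 3 → ℝ => a i) (𝓝 fun _ => c) (𝓝 c) :=
        (continuous_apply i).tendsto _
      have h2 := (hg.continuousAt hc).tendsto.comp h1
      rw [hgc] at h2
      exact h2.mono_left inf_le_left)
  have h3 : ∑ _i : Fin 3, 1 = 3 := rfl
  rw [h3] at hlim
  have hsec := (continuousAt_chartSection ![1, 0, 0]
    (piece_three_mem_chartDomain hξ hb hy)).tendsto.comp hlim
  have hb1 : chartSection (coordMap b ![1, 2, 3] : (Fin 4 → ℝ) →ₗ[ℝ] Fin 3 → ℝ) ![1, 0, 0]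
      ((ξ y).piece 3) = b 1 := by
    refine chartSection_eq (piece_three_mem_chartDomain hξ hb hy).2 ?_ ?_
    · have : b 1 ∈ viewPoint ξ x y := (hb.mem_viewPoint _).2 (by simp)
      exact this.2
    · ext i
      fin_cases i <;> simp
  rw [hb1] at hsec
  have h0 := ((LinearMap.continuous_of_finiteDimensional (b.coord 0)).tendsto _).comp hsec
  have hb10 : b.coord 0 (b 1) = 0 := by simp
  rw [hb10] at h0
  refine h0.congr' ?_
  filter_upwards [hev] with a ha
  have hA := hg.secondDiff_ne_zero hξ hb (ha.1 0) (ha.1 1) (ha.1 2) (ha.2 (by decide))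
    (ha.2 (by decide))
  set A := secondDiff (height ξ b g 1) (a 0) (a 1) (a 2) with hAdef
  have : chartSection (coordMap b ![1, 2, 3] : (Fin 4 → ℝ) →ₗ[ℝ] Fin 3 → ℝ) ![1, 0, 0]
      (⨆ i, (ξ (g (a i))).piece 1) = A⁻¹ • tripleComb ξ b g (a 0) (a 1) (a 2) := by
    refine chartSection_eq ?_ (Submodule.smul_mem _ _ ?_) ?_
    · rw [hb.ker_three]
      exact hξ.disjoint_iSup (k := fun _ => 1) (by simp) (hg.injective_comp ha)
        fun i => hg.ne _ (ha.1 i)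
    · have hm : ∀ i, affineLift ξ b (g (a i)) ∈ ⨆ i, (ξ (g (a i))).piece 1 := fun i =>
        Submodule.mem_iSup_of_mem i (affineLift_mem hξ hb (hg.ne _ (ha.1 i)))
      exact Submodule.add_mem _ (Submodule.sub_mem _ (Submodule.smul_mem _ _ (hm 0))
        (Submodule.smul_mem _ _ (hm 1))) (Submodule.smul_mem _ _ (hm 2))
    · rw [map_smul]
      refine funext (Fin.forall_fin_succ.2 ⟨?_, Fin.forall_fin_two.2 ⟨?_, ?_⟩⟩)
      · change A⁻¹ * b.coord 1 _ = 1
        rw [coord_tripleComb, ← hAdef, inv_mul_cancel₀ hA]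
      · change A⁻¹ * b.coord 2 _ = 0
        rw [hg.coord_two_tripleComb (ha.1 0) (ha.1 1) (ha.1 2), mul_zero]
      · change A⁻¹ * b.coord 3 _ = 0
        rw [hg.coord_three_tripleComb hξ hb (ha.1 0) (ha.1 1) (ha.1 2), mul_zero]
  simp only [Function.comp_apply]
  rw [this, map_smul, coord_tripleComb, smul_eq_mul, div_eq_inv_mul]

theorem exists_sign (hg : IsFrontParam ξ x b J g) (hξ : IsHyperconvexFrenet ξ)
    (hb : IsFrontBasis ξ x y b) {c : ℝ} (hc : c ∈ J) (hgc : g c = y) :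
    ∃ ε : ℝ, (ε = 1 ∨ ε = -1) ∧
    (∀ r ∈ J, ∀ s ∈ J, ∀ t ∈ J, r < s → s < t → t ≤ c →
      ε * secondDiff (height ξ b g 0) r s t < 0) ∧
    (∀ r ∈ J, ∀ s ∈ J, ∀ t ∈ J, r < s → s < t → c ≤ r →
      0 < ε * secondDiff (height ξ b g 0) r s t) := by
  refine secondDiff_sign hg.isOpen hg.ordConnected hc (hg.continuousOn_height hξ hb 0)
    (hg.continuousOn_height hξ hb 1)
    (fun r hr s hs t ht => hg.secondDiff_ne_zero hξ hb hr hs ht)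
    (fun r hr s hs t ht q hq => hg.planarDet_ne_zero hξ hb hr hs ht hq) fun δ hδ => ?_
  have h := (hg.tendsto_secondDiff_div hξ hb hc hgc).eventually (Metric.ball_mem_nhds 0 hδ)
  rw [eventually_inf_principal] at h
  obtain ⟨η, hη, h⟩ := Metric.eventually_nhds_iff.1 h
  refine ⟨η, hη, fun r hr s hs t ht hrs hst h1 h2 => ?_⟩
  have := h (y := ![r, s, t]) ((dist_pi_lt_iff hη).2 fun i => ?_)
    (mem_increasingTuples_three hr hs ht hrs hst)
  · simpa only [Metric.mem_ball, dist_zero_right, Real.norm_eq_abs, Matrix.cons_val] using this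
  · rw [Real.dist_eq, abs_lt]
    fin_cases i <;> simp only [Fin.reduceFinMk, Fin.mk_one, Fin.zero_eta, Matrix.cons_val] <;>
      constructor <;> linarith

end IsFrontParam

end Parametrization

/-! ### The projected flags -/

section FrontFlag

lemma eq_top_of_linearIndependent_mem {V : Type*} [AddCommGroup V] [Module ℝ V]
    [FiniteDimensional ℝ V] (hV : Module.finrank ℝ V = 3) {q : Fin 3 → V}
    (hq : LinearIndependent ℝ q) {S : Submodule ℝ V} (hS : ∀ i, q i ∈ S) : S = ⊤ := by
  rw [eq_top_iff, ← hq.span_eq_top_of_card_eq_finrank (by simp [hV])]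
  exact Submodule.span_le.2 (range_subset_iff.2 hS)

/-- The second difference is alternating in its arguments, so sorting them changes at most its sign.
-/
lemma secondDiff_ne_zero_of_ne {u : ℝ → ℝ} {T : Set ℝ}
    (h : ∀ r ∈ T, ∀ s ∈ T, ∀ t ∈ T, r < s → s < t → secondDiff u r s t ≠ 0) {r s t : ℝ}
    (hr : r ∈ T) (hs : s ∈ T) (ht : t ∈ T) (hrs : r ≠ s) (hst : s ≠ t) (hrt : r ≠ t) :
    secondDiff u r s t ≠ 0 := by
  intro h0
  rcases hrs.lt_or_gt with h1 | h1 <;> rcases hst.lt_or_gt with h2 | h2 <;>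
    rcases hrt.lt_or_gt with h3 | h3
  · exact h r hr s hs t ht h1 h2 h0
  · linarith
  · refine h r hr t ht s hs h3 h2 ?_
    simp only [secondDiff] at h0 ⊢
    linarith
  · refine h t ht r hr s hs h3 h1 ?_
    simp only [secondDiff] at h0 ⊢
    linarith
  · refine h s hs r hr t ht h1 h3 ?_
    simp only [secondDiff] at h0 ⊢
    linarith
  · refine h s hs t ht r hr h2 h3 ?_
    simp only [secondDiff] at h0 ⊢
    linarith
  · linarith
  · refine h t ht s hs r hr h2 h1 ?_
    simp only [secondDiff] at h0 ⊢
    linarith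

variable {X : Type*} [TopologicalSpace X] {ξ : X → FullFlag (Fin 4 → ℝ)} {x y : X}
  {b : Module.Basis (Fin 4) ℝ (Fin 4 → ℝ)}

/-- The projection onto `P_xy` along `p_xy`. -/
noncomputable def viewProjection (hξ : IsHyperconvexFrenet ξ) (hxy : x ≠ y) :
    (Fin 4 → ℝ) →L[ℝ] viewPlane ξ x y :=
  LinearMap.toContinuousLinearMap
    ((viewPlane ξ x y).projectionOnto (viewPoint ξ x y) (isCompl_viewPlane hξ hxy))

/-- The image of a subspace under the projection onto `P_xy` along `p_xy`. -/
noncomputable def viewMap (hξ : IsHyperconvexFrenet ξ) (hxy : x ≠ y)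
    (W : Submodule ℝ (Fin 4 → ℝ)) : Submodule ℝ (viewPlane ξ x y) :=
  W.map (viewProjection hξ hxy : (Fin 4 → ℝ) →ₗ[ℝ] viewPlane ξ x y)

variable (hξ : IsHyperconvexFrenet ξ) (hxy : x ≠ y)

lemma frontProj_eq_viewMap (k : ℕ) (w : X) :
    frontProj ξ x y k w = viewMap hξ hxy ((ξ w).piece k) :=
  sup_submoduleOf_eq_map (isCompl_viewPlane hξ hxy) _

lemma ker_viewProjection :
    LinearMap.ker (viewProjection hξ hxy : (Fin 4 → ℝ) →ₗ[ℝ] viewPlane ξ x y) =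
      viewPoint ξ x y := by
  ext z
  exact Submodule.projectionOnto_apply_eq_zero_iff (isCompl_viewPlane hξ hxy)

lemma viewProjection_coe (q : viewPlane ξ x y) : viewProjection hξ hxy q = q :=
  Submodule.projectionOnto_apply_left (isCompl_viewPlane hξ hxy) q

lemma viewMap_eq_submoduleOf {W : Submodule ℝ (Fin 4 → ℝ)} (hW : W ≤ viewPlane ξ x y) :
    viewMap hξ hxy W = W.submoduleOf (viewPlane ξ x y) := by
  ext q
  rw [viewMap, Submodule.mem_map, Submodule.submoduleOf, Submodule.mem_comap]
  constructor
  · rintro ⟨z, hz, rfl⟩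
    have := viewProjection_coe hξ hxy ⟨z, hW hz⟩
    rw [ContinuousLinearMap.coe_coe, this]
    exact hz
  · intro hq
    exact ⟨q, hq, viewProjection_coe hξ hxy q⟩

lemma coord_viewProjection (hb : IsFrontBasis ξ x y b) (z : Fin 4 → ℝ) :
    b.coord 0 (viewProjection hξ hxy z : Fin 4 → ℝ) = b.coord 0 z ∧
    b.coord 2 (viewProjection hξ hxy z : Fin 4 → ℝ) = b.coord 2 z ∧
    b.coord 3 (viewProjection hξ hxy z : Fin 4 → ℝ) = b.coord 3 z := by
  have h : (viewProjection hξ hxy z : Fin 4 → ℝ) - z ∈ viewPoint ξ x y := by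
    rw [← ker_viewProjection hξ hxy, LinearMap.mem_ker, map_sub, ContinuousLinearMap.coe_coe,
      viewProjection_coe, sub_self]
  have := (hb.mem_viewPoint _).1 h
  simp only [map_sub, sub_eq_zero] at this
  exact this

/-- Coordinate `1` is the direction of `p_xy`, which is complementary to the plane, so the other
three coordinates separate its points. -/
lemma viewPlane_ext (hξ : IsHyperconvexFrenet ξ) (hxy : x ≠ y) (hb : IsFrontBasis ξ x y b) {q q' : viewPlane ξ x y}
    (h0 : b.coord 0 (q : Fin 4 → ℝ) = b.coord 0 (q' : Fin 4 → ℝ))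
    (h2 : b.coord 2 (q : Fin 4 → ℝ) = b.coord 2 (q' : Fin 4 → ℝ))
    (h3 : b.coord 3 (q : Fin 4 → ℝ) = b.coord 3 (q' : Fin 4 → ℝ)) : q = q' := by
  have h := Submodule.disjoint_def.1 (isCompl_viewPlane hξ hxy).disjoint _ (q - q').2
    ((hb.mem_viewPoint _).2 (by
      simp only [Submodule.coe_sub, map_sub, sub_eq_zero]
      exact ⟨h0, h2, h3⟩))
  exact sub_eq_zero.1 (Subtype.ext h)

lemma disjoint_ker_viewProjection {w : X} (hw : w ≠ x) {k : ℕ} (hk : k ≤ 2) :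
    Disjoint ((ξ w).piece k)
      (LinearMap.ker (viewProjection hξ hxy : (Fin 4 → ℝ) →ₗ[ℝ] viewPlane ξ x y)) := by
  rw [ker_viewProjection]
  exact (hξ.disjoint (k := 2) (m := 2) hw (by simp)).mono ((ξ w).mono hk) inf_le_left

lemma finrank_viewMap {w : X} (hw : w ≠ x) {k : ℕ} (hk : k ≤ 2) :
    Module.finrank ℝ (viewMap hξ hxy ((ξ w).piece k)) = k := by
  have hd := disjoint_ker_viewProjection hξ hxy hw hk
  have hinj : Function.Injective
      ((viewProjection hξ hxy : (Fin 4 → ℝ) →ₗ[ℝ] viewPlane ξ x y).domRestrict ((ξ w).piece k)) := by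
    rw [← LinearMap.ker_eq_bot, LinearMap.ker_eq_bot']
    intro z hz
    exact Subtype.ext (Submodule.disjoint_def.1 hd z z.2 hz)
  have h1 := LinearMap.finrank_range_of_inj hinj
  rw [LinearMap.range_domRestrict, FullFlag.finrank_piece] at h1
  rw [viewMap, h1]
  simp
  omega

lemma continuousAt_viewMap {w : X} (hw : w ≠ x) {k : ℕ} (hk : k ≤ 2) :
    ContinuousAt (viewMap hξ hxy) ((ξ w).piece k) :=
  continuousAt_map _ (disjoint_ker_viewProjection hξ hxy hw hk)

lemma exists_frontFlag : ∃ σ : {w : X // w ≠ x} → FullFlag (viewPlane ξ x y),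
    (∀ w, ∀ k ≤ 2, (σ w).piece k = viewMap hξ hxy ((ξ w).piece k)) ∧
    ∀ w, ∀ k, 3 ≤ k → (σ w).piece k = ⊤ := by
  refine ⟨fun w => ⟨fun k => if k ≤ 2 then viewMap hξ hxy ((ξ w).piece k) else ⊤, ?_, ?_⟩,
    fun w k hk => if_pos hk, fun w k hk => if_neg (by omega)⟩
  · intro k l hkl
    by_cases hl : l ≤ 2
    · simp only [if_pos hl, if_pos (hkl.trans hl)]
      exact Submodule.map_mono ((ξ w).mono hkl)
    · simp only [if_neg hl, le_top]
  · intro k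
    rw [finrank_viewPlane hξ hxy]
    by_cases hk : k ≤ 2
    · rw [if_pos hk, finrank_viewMap hξ hxy w.2 hk]
      omega
    · rw [if_neg hk, finrank_top, finrank_viewPlane hξ hxy]
      omega

variable {J : Set ℝ} {g : ℝ → X}

lemma viewProjection_affineLift_mem (hb : IsFrontBasis ξ x y b) {w : X} (hw : w ≠ x) {k : ℕ}
    (hk : 1 ≤ k) : viewProjection hξ hxy (affineLift ξ b w) ∈ viewMap hξ hxy ((ξ w).piece k) :=
  Submodule.mem_map_of_mem ((ξ w).mono hk (affineLift_mem hξ hb hw))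

lemma viewProjection_tangentLift_mem (hb : IsFrontBasis ξ x y b) {w : X} (hw : w ≠ x) :
    viewProjection hξ hxy (tangentLift ξ b w) ∈ viewMap hξ hxy ((ξ w).piece 2) :=
  Submodule.mem_map_of_mem (tangentLift_mem hξ hb hw)

/-- Three points of the projected curve that are not collinear span the plane. -/
lemma linearIndependent_points (hb : IsFrontBasis ξ x y b) (hg : IsFrontParam ξ x b J g)
    {r s t : ℝ} (hr : r ∈ J) (hs : s ∈ J) (ht : t ∈ J)
    (h : secondDiff (height ξ b g 0) r s t ≠ 0) :
    LinearIndependent ℝ ![viewProjection hξ hxy (affineLift ξ b (g r)),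
      viewProjection hξ hxy (affineLift ξ b (g s)),
      viewProjection hξ hxy (affineLift ξ b (g t))] := by
  rw [Fintype.linearIndependent_iff]
  intro a ha
  simp only [Fin.sum_univ_three, Matrix.cons_val] at ha
  rw [← map_smul, ← map_smul, ← map_smul, ← map_add, ← map_add] at ha
  have hc := coord_viewProjection hξ hxy hb
    (a 0 • affineLift ξ b (g r) + a 1 • affineLift ξ b (g s) + a 2 • affineLift ξ b (g t))
  rw [ha] at hc
  simp only [ZeroMemClass.coe_zero, map_zero, map_add, map_smul, smul_eq_mul, hg.coord r hr,
    hg.coord s hs, hg.coord t ht, coord_three_affineLift hξ hb (hg.ne r hr),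
    coord_three_affineLift hξ hb (hg.ne s hs), coord_three_affineLift hξ hb (hg.ne t ht)] at hc
  obtain ⟨h0, h2, h3⟩ := hc
  simp only [secondDiff, height] at h
  set ur := b.coord 0 (affineLift ξ b (g r))
  set us := b.coord 0 (affineLift ξ b (g s))
  set ut := b.coord 0 (affineLift ξ b (g t))
  intro i
  -- Cramer's rule: the multipliers below are cofactors of the matrix with rows `(u, t, 1)` at the
  -- three points.
  refine (mul_eq_zero.1 (?_ : ((t - s) * ur - (t - r) * us + (s - r) * ut) * a i = 0)).resolve_left h
  fin_cases i <;> simp only [Fin.reduceFinMk, Fin.mk_one, Fin.zero_eta]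
  · linear_combination (s - t) * h0 - (us - ut) * h2 + (us * t - ut * s) * h3
  · linear_combination (t - r) * h0 - (ut - ur) * h2 + (ut * r - ur * t) * h3
  · linear_combination (r - s) * h0 - (ur - us) * h2 + (ur * s - us * r) * h3

/-- A tangent line of the projected curve and a point of the curve outside of it span the plane. -/
lemma linearIndependent_tangent (hb : IsFrontBasis ξ x y b) (hg : IsFrontParam ξ x b J g)
    {r s : ℝ} (hr : r ∈ J) (hs : s ∈ J)
    (h : height ξ b g 0 s - height ξ b g 0 r -
      b.coord 0 (tangentLift ξ b (g r)) * (s - r) ≠ 0) :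
    LinearIndependent ℝ ![viewProjection hξ hxy (affineLift ξ b (g r)),
      viewProjection hξ hxy (tangentLift ξ b (g r)),
      viewProjection hξ hxy (affineLift ξ b (g s))] := by
  rw [Fintype.linearIndependent_iff]
  intro a ha
  simp only [Fin.sum_univ_three, Matrix.cons_val] at ha
  rw [← map_smul, ← map_smul, ← map_smul, ← map_add, ← map_add] at ha
  have hc := coord_viewProjection hξ hxy hb
    (a 0 • affineLift ξ b (g r) + a 1 • tangentLift ξ b (g r) + a 2 • affineLift ξ b (g s))
  rw [ha] at hc
  simp only [ZeroMemClass.coe_zero, map_zero, map_add, map_smul, smul_eq_mul, hg.coord r hr,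
    hg.coord s hs, coord_three_affineLift hξ hb (hg.ne r hr),
    coord_three_affineLift hξ hb (hg.ne s hs), coord_two_tangentLift hξ hb (hg.ne r hr),
    coord_three_tangentLift hξ hb (hg.ne r hr)] at hc
  obtain ⟨h0, h2, h3⟩ := hc
  simp only [height] at h
  have ha2 : a 2 = 0 := by
    refine (mul_eq_zero.1 (?_ : _ * a 2 = 0)).resolve_left h
    linear_combination -h0 + b.coord 0 (tangentLift ξ b (g r)) * h2 +
      (b.coord 0 (affineLift ξ b (g r)) - b.coord 0 (tangentLift ξ b (g r)) * r) * h3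
  rw [ha2] at h0 h2 h3
  have ha0 : a 0 = 0 := by linarith
  rw [ha0] at h2
  have ha1 : a 1 = 0 := by linarith
  intro i
  fin_cases i
  exacts [ha0, ha1, ha2]

end FrontFlag

/-! ### Hyperconvexity of the projected curve -/

section FrontFrenet

variable {X : Type*} [TopologicalSpace X] {ξ : X → FullFlag (Fin 4 → ℝ)} {x y : X}
  {b : Module.Basis (Fin 4) ℝ (Fin 4 → ℝ)} {J : Set ℝ} {g : ℝ → X}
  (hξ : IsHyperconvexFrenet ξ) (hxy : x ≠ y)

/-- The ways in which natural numbers can add up to `3`. -/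
lemma exists_of_sum_eq_three {j : ℕ} {k : Fin j → ℕ} (hk : ∑ l, k l = 3) :
    (∃ l, 3 ≤ k l) ∨ (∃ l m, l ≠ m ∧ k l = 2 ∧ 1 ≤ k m) ∨
      ∃ l m n, l ≠ m ∧ m ≠ n ∧ l ≠ n ∧ k l = 1 ∧ k m = 1 ∧ k n = 1 := by
  by_cases h3 : ∃ l, 3 ≤ k l
  · exact Or.inl h3
  push Not at h3
  by_cases h2 : ∃ l, k l = 2
  · obtain ⟨l, hl⟩ := h2
    refine Or.inr (Or.inl ?_)
    by_contra! hcon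
    have : ∑ m, k m = k l := Finset.sum_eq_single l
      (fun m _ hm => by have := hcon l m hm.symm hl; omega) (by simp)
    omega
  · push Not at h2
    have h01 : ∀ l, k l = if k l = 1 then 1 else 0 := fun l => by
      have := h3 l
      have := h2 l
      split_ifs <;> omega
    rw [Finset.sum_congr rfl fun l _ => h01 l, ← Finset.card_filter, Finset.card_eq_three] at hk
    obtain ⟨l, m, n, hlm, hln, hmn, heq⟩ := hk
    have hmem : ∀ i, i ∈ ({l, m, n} : Finset (Fin j)) → k i = 1 := fun i hi => by
      rw [← heq] at hi
      exact (Finset.mem_filter.1 hi).2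
    exact Or.inr (Or.inr ⟨l, m, n, hlm, hmn, hln, hmem l (by simp), hmem m (by simp),
      hmem n (by simp)⟩)

variable {σ : {w : X // w ≠ x} → FullFlag (viewPlane ξ x y)}

lemma continuous_frontFlag (hσ : ∀ w, ∀ k ≤ 2, (σ w).piece k = viewMap hξ hxy ((ξ w).piece k))
    (hσ3 : ∀ w, ∀ k, 3 ≤ k → (σ w).piece k = ⊤) : Continuous σ := by
  refine continuous_induced_rng.2 (continuous_pi fun k => ?_)
  by_cases hk : k ≤ 2
  · refine Continuous.congr (f := fun w : {w : X // w ≠ x} => viewMap hξ hxy ((ξ w).piece k)) ?_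
      fun w => (hσ w k hk).symm
    refine continuous_iff_continuousAt.2 fun w => ?_
    exact ContinuousAt.comp (g := viewMap hξ hxy) (f := fun w : {w : X // w ≠ x} => (ξ w).piece k)
      (continuousAt_viewMap hξ hxy w.2 hk)
      ((hξ.continuous_piece k).comp continuous_subtype_val).continuousAt
  · exact continuous_const.congr fun w => (hσ3 w k (by omega)).symm

/-- Up to zeros, the multiplicities are `3`, `2 + 1` or `1 + 1 + 1`. The second case uses `hT'`,
that a tangent does not meet the curve again; the third uses `hT`, that no three points are
collinear. -/
lemma iSup_frontFlag_eq_top (hb : IsFrontBasis ξ x y b) (hg : IsFrontParam ξ x b J g)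
    (hσ : ∀ w, ∀ k ≤ 2, (σ w).piece k = viewMap hξ hxy ((ξ w).piece k))
    (hσ3 : ∀ w, ∀ k, 3 ≤ k → (σ w).piece k = ⊤) {T : Set ℝ} (hTJ : T ⊆ J)
    (hT : ∀ r ∈ T, ∀ s ∈ T, ∀ t ∈ T, r < s → s < t → secondDiff (height ξ b g 0) r s t ≠ 0)
    (hT' : ∀ r ∈ T, ∀ s ∈ T, r ≠ s → height ξ b g 0 s - height ξ b g 0 r -
      b.coord 0 (tangentLift ξ b (g r)) * (s - r) ≠ 0)
    {j : ℕ} {k : Fin j → ℕ} {w : Fin j → {w : X // w ≠ x}} (hk : ∑ l, k l = 3)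
    (hw : Function.Injective w) (hwT : ∀ l, b.coord 2 (affineLift ξ b (w l).1) ∈ T) :
    ⨆ l, (σ (w l)).piece (k l) = ⊤ := by
  have hne : ∀ l m, l ≠ m →
      b.coord 2 (affineLift ξ b (w l).1) ≠ b.coord 2 (affineLift ξ b (w m).1) := fun l m hlm h =>
    hlm (hw (Subtype.ext (injOn_coord_two_affineLift hξ hb (w l).2 (w m).2 h)))
  have hinv : ∀ l, g (b.coord 2 (affineLift ξ b (w l).1)) = (w l).1 := fun l =>
    hg.inv _ (w l).2
  have h3 := finrank_viewPlane hξ hxy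
  have hpt : ∀ l, 1 ≤ k l → k l ≤ 2 →
      viewProjection hξ hxy (affineLift ξ b (w l).1) ∈ ⨆ l, (σ (w l)).piece (k l) := by
    intro l h1 h2
    refine Submodule.mem_iSup_of_mem l ?_
    rw [hσ _ _ h2]
    exact viewProjection_affineLift_mem hξ hxy hb (w l).2 h1
  rcases exists_of_sum_eq_three hk with ⟨l, hl⟩ | ⟨l, m, hlm, hl, hm⟩ |
    ⟨l, m, n, hlm, hmn, hln, hl, hm, hn⟩
  · exact top_le_iff.1 ((hσ3 (w l) _ hl).symm.le.trans (le_iSup (fun l => (σ (w l)).piece (k l)) l))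
  · have hm2 : k m ≤ 2 := by
      have := Finset.add_le_sum (f := k) (fun _ _ => Nat.zero_le _) (Finset.mem_univ l)
        (Finset.mem_univ m) hlm
      omega
    have hli := linearIndependent_tangent hξ hxy hb hg (hTJ (hwT l)) (hTJ (hwT m))
      (hT' _ (hwT l) _ (hwT m) (hne l m hlm))
    rw [hinv, hinv] at hli
    refine eq_top_of_linearIndependent_mem h3 hli
      (Fin.forall_fin_succ.2 ⟨hpt l (by omega) (by omega), Fin.forall_fin_two.2 ⟨?_, hpt m hm hm2⟩⟩)
    refine Submodule.mem_iSup_of_mem l ?_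
    rw [hσ _ _ hl.le, hl]
    exact viewProjection_tangentLift_mem hξ hxy hb (w l).2
  · have hli := linearIndependent_points hξ hxy hb hg (hTJ (hwT l)) (hTJ (hwT m)) (hTJ (hwT n))
      (secondDiff_ne_zero_of_ne hT (hwT l) (hwT m) (hwT n) (hne l m hlm) (hne m n hmn)
        (hne l n hln))
    rw [hinv, hinv, hinv] at hli
    exact eq_top_of_linearIndependent_mem h3 hli
      (Fin.forall_fin_succ.2 ⟨hpt l (by omega) (by omega), Fin.forall_fin_two.2
        ⟨hpt m (by omega) (by omega), hpt n (by omega) (by omega)⟩⟩)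

/-- For total multiplicity at most `2`, both conditions descend from `ξ`, since the sums are
transverse to `ξ²(x)` and so avoid `p_xy`. For total `3` the sums are the whole plane: directness
follows by counting dimensions, and the limit is constant. -/
theorem isHyperconvexFrenet_frontFlag (hb : IsFrontBasis ξ x y b) (hg : IsFrontParam ξ x b J g)
    (hσ : ∀ w, ∀ k ≤ 2, (σ w).piece k = viewMap hξ hxy ((ξ w).piece k))
    (hσ3 : ∀ w, ∀ k, 3 ≤ k → (σ w).piece k = ⊤) {T : Set ℝ} (hTJ : T ⊆ J)
    (hT : ∀ r ∈ T, ∀ s ∈ T, ∀ t ∈ T, r < s → s < t → secondDiff (height ξ b g 0) r s t ≠ 0)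
    (hT' : ∀ r ∈ T, ∀ s ∈ T, r ≠ s → height ξ b g 0 s - height ξ b g 0 r -
      b.coord 0 (tangentLift ξ b (g r)) * (s - r) ≠ 0)
    {I : Set {w : X // w ≠ x}} (hI : ∀ w ∈ I, b.coord 2 (affineLift ξ b w.1) ∈ T) :
    IsHyperconvexFrenet (I.domRestrict σ) := by
  have h3 := finrank_viewPlane hξ hxy
  have hmap : ∀ {j : ℕ} {k : Fin j → ℕ} (w : Fin j → I), (∀ l, k l ≤ 2) →
      (fun l => (I.domRestrict σ (w l)).piece (k l)) =
        fun l => viewMap hξ hxy ((ξ (w l).1.1).piece (k l)) := fun w hk =>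
    funext fun l => hσ _ _ (hk l)
  have hiSup : ∀ {j : ℕ} {k : Fin j → ℕ} (w : Fin j → I), (∀ l, k l ≤ 2) →
      ⨆ l, (I.domRestrict σ (w l)).piece (k l) =
        viewMap hξ hxy (⨆ l, (ξ (w l).1.1).piece (k l)) := fun w hk => by
    rw [hmap _ hk, viewMap, Submodule.map_iSup]
    rfl
  have hinj : ∀ {j : ℕ} {w : Fin j → I}, Function.Injective w →
      Function.Injective fun l => (w l).1.1 := fun hw =>
    Subtype.val_injective.comp (Subtype.val_injective.comp hw)
  have htop : ∀ {j : ℕ} {k : Fin j → ℕ} {w : Fin j → I}, ∑ l, k l = 3 → Function.Injective w →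
      ⨆ l, (I.domRestrict σ (w l)).piece (k l) = ⊤ := fun {_ _ w} hk hw =>
    iSup_frontFlag_eq_top hξ hxy hb hg hσ hσ3 hTJ hT hT' hk (Subtype.val_injective.comp hw)
      fun l => hI _ (w l).2
  refine ⟨(continuous_frontFlag hξ hxy hσ hσ3).comp continuous_subtype_val, ?_, ?_⟩
  · intro j k w hk hw
    rw [h3] at hk
    -- The projection need not be injective on `ξ³(w)`. A multiplicity of `3` forces all others to
    -- vanish and is settled separately.
    by_cases hbig : ∃ l, 3 ≤ k l
    · obtain ⟨l, hl⟩ := hbig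
      have hz : ∀ m, m ≠ l → k m = 0 := fun m hm => by
        have := Finset.add_le_sum (f := k) (fun _ _ => Nat.zero_le _) (Finset.mem_univ l)
          (Finset.mem_univ m) hm.symm
        omega
      rw [iSupIndep_def]
      intro i
      by_cases hi : i = l
      · refine Disjoint.mono_right (iSup₂_le fun m hm => ?_) disjoint_bot_right
        rw [hz m (hi ▸ hm), FullFlag.piece_zero]
      · rw [hz i hi, FullFlag.piece_zero]
        exact disjoint_bot_left
    · push Not at hbig
      have hk2 : ∀ l, k l ≤ 2 := fun l => by have := hbig l; omega
      rw [hmap w hk2]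
      refine iSupIndep_map _ (hξ.general_position j k (fun l => (w l).1.1) (by simp; omega)
        (hinj hw)) ?_
      rcases hk.lt_or_eq with hlt | heq
      · rw [ker_viewProjection]
        exact (hξ.disjoint_iSup (m := 2) (x := x) (by simp; omega) (hinj hw)
          fun l => (w l).1.2).mono_right inf_le_left
      · refine disjoint_ker_of_map_eq_top _ ((hiSup w hk2).symm.trans (htop heq hw)) ?_
        refine (finrank_iSup_le _).trans ?_
        rw [h3, ← heq]
        exact Finset.sum_le_sum fun l _ => by rw [FullFlag.finrank_piece]; exact min_le_left _ _
  · intro j k w u hk hu hlim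
    rw [h3] at hk
    rcases hk.lt_or_eq with hlt | heq
    · have hk2 : ∀ l, k l ≤ 2 := fun l => by
        have := Finset.single_le_sum (f := k) (fun _ _ => Nat.zero_le _) (Finset.mem_univ l)
        omega
      simp only [hiSup _ hk2]
      rw [domRestrict_apply, hσ _ _ (by omega)]
      refine (continuousAt_viewMap hξ hxy w.1.2 (by omega)).tendsto.comp
        (hξ.limit_compatibility j k w.1.1 (fun m l => (u m l).1.1) (by simp; omega)
          (fun m => hinj (hu m)) fun l => ?_)
      exact ((continuous_subtype_val.comp continuous_subtype_val).tendsto w).comp (hlim l)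
    · rw [heq, domRestrict_apply, hσ3 _ 3 le_rfl]
      exact tendsto_const_nhds.congr fun m => (htop heq (hu m)).symm

end FrontFrenet

/-! ### The curve near `ξ¹(y)`: regularity and crossing -/

section LocalParam

variable {X : Type*} [TopologicalSpace X] {ξ : X → FullFlag (Fin 4 → ℝ)} {x y : X}
  {b : Module.Basis (Fin 4) ℝ (Fin 4 → ℝ)} {J : Set ℝ} {g : ℝ → X}
  (hξ : IsHyperconvexFrenet ξ) (hxy : x ≠ y)

/-- The projected curve, as a parametrized curve centred at the parameter `c`. -/
noncomputable def frontCurve (b : Module.Basis (Fin 4) ℝ (Fin 4 → ℝ)) (g : ℝ → X) (c s : ℝ) :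
    viewPlane ξ x y := viewProjection hξ hxy (affineLift ξ b (g (c + s)))

lemma hasDerivAt_frontCurve (hb : IsFrontBasis ξ x y b) (hg : IsFrontParam ξ x b J g) {c s : ℝ}
    (hs : c + s ∈ J) : HasDerivAt (frontCurve hξ hxy b g c)
      (viewProjection hξ hxy (tangentLift ξ b (g (c + s)))) s :=
  (viewProjection hξ hxy).hasFDerivAt.comp_hasDerivAt s
    (HasDerivAt.comp_const_add c s (hg.hasDerivAt hξ hb hs))

lemma coord_two_frontCurve (hb : IsFrontBasis ξ x y b) (hg : IsFrontParam ξ x b J g) {c s : ℝ}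
    (hs : c + s ∈ J) : b.coord 2 (frontCurve hξ hxy b g c s : Fin 4 → ℝ) = c + s := by
  rw [frontCurve, (coord_viewProjection hξ hxy hb _).2.1, hg.coord _ hs]

lemma coord_three_frontCurve (hb : IsFrontBasis ξ x y b) (hg : IsFrontParam ξ x b J g) {c s : ℝ}
    (hs : c + s ∈ J) : b.coord 3 (frontCurve hξ hxy b g c s : Fin 4 → ℝ) = 1 := by
  rw [frontCurve, (coord_viewProjection hξ hxy hb _).2.2,
    coord_three_affineLift hξ hb (hg.ne _ hs)]

lemma span_viewProjection_affineLift (hb : IsFrontBasis ξ x y b) {w : X} (hw : w ≠ x) :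
    Submodule.span ℝ {viewProjection hξ hxy (affineLift ξ b w)} =
      viewMap hξ hxy ((ξ w).piece 1) := by
  rw [← span_affineLift hξ hb hw, viewMap, Submodule.map_span, image_singleton]
  rfl

/-- The affine coordinate on lines of `P_xy`. -/
noncomputable def lineCoord (b : Module.Basis (Fin 4) ℝ (Fin 4 → ℝ)) (P : Submodule ℝ (Fin 4 → ℝ))
    (L : Submodule ℝ P) : ℝ :=
  b.coord 2 ((chartSection ((coordMap b ![3]).comp P.subtypeL : P →ₗ[ℝ] Fin 1 → ℝ) ![1] L : P) :
    Fin 4 → ℝ)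

lemma span_mem_chartDomain_and_lineCoord {P : Submodule ℝ (Fin 4 → ℝ)} {q : P}
    (hq : b.coord 3 (q : Fin 4 → ℝ) = 1) :
    Submodule.span ℝ {q} ∈ chartDomain ((coordMap b ![3]).comp P.subtypeL) ∧
      lineCoord b P (Submodule.span ℝ {q}) = b.coord 2 (q : Fin 4 → ℝ) := by
  have hd : Disjoint (Submodule.span ℝ {q})
      (LinearMap.ker ((coordMap b ![3]).comp P.subtypeL : P →ₗ[ℝ] Fin 1 → ℝ)) := by
    refine Submodule.disjoint_def.2 fun z hz h => ?_
    obtain ⟨a, rfl⟩ := Submodule.mem_span_singleton.1 hz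
    have h0 : b.coord 3 ((a • q : P) : Fin 4 → ℝ) = 0 := congrFun h 0
    rw [Submodule.coe_smul, map_smul, hq, smul_eq_mul, mul_one] at h0
    rw [h0, zero_smul]
  refine ⟨⟨finrank_span_singleton fun h => ?_, hd⟩, ?_⟩
  · simp [h] at hq
  · rw [lineCoord, chartSection_eq hd (Submodule.mem_span_singleton_self q)]
    ext i
    fin_cases i
    exact hq

lemma continuousOn_lineCoord (P : Submodule ℝ (Fin 4 → ℝ)) :
    ContinuousOn (lineCoord b P) (chartDomain ((coordMap b ![3]).comp P.subtypeL)) :=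
  (LinearMap.continuous_of_finiteDimensional (b.coord 2)).comp_continuousOn
    (continuous_subtype_val.comp_continuousOn
      (continuousOn_chartSection ((coordMap b ![3]).comp P.subtypeL) ![1]))

theorem isC1LocalParam_frontCurve (hb : IsFrontBasis ξ x y b) (hg : IsFrontParam ξ x b J g)
    {c ρ : ℝ} (hρ : 0 < ρ) (hJ : Ioo (c - ρ) (c + ρ) ⊆ J) (hgc : g c = y) :
    IsC1LocalParam (range fun w : {w : X // w ≠ x} => viewMap hξ hxy ((ξ w).piece 1))
      (viewMap hξ hxy ((ξ y).piece 1)) ρ (frontCurve hξ hxy b g c) := by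
  have hmem : ∀ s ∈ Ioo (-ρ) ρ, c + s ∈ J := fun s hs =>
    hJ ⟨by linarith [hs.1], by linarith [hs.2]⟩
  have hspan : ∀ s ∈ Ioo (-ρ) ρ, Submodule.span ℝ {frontCurve hξ hxy b g c s} =
      viewMap hξ hxy ((ξ (g (c + s))).piece 1) := fun s hs =>
    span_viewProjection_affineLift hξ hxy hb (hg.ne _ (hmem s hs))
  have hchart := fun s (hs : s ∈ Ioo (-ρ) ρ) =>
    span_mem_chartDomain_and_lineCoord (coord_three_frontCurve hξ hxy hb hg (hmem s hs))
  have hcurve : ContDiffOn ℝ 1 (frontCurve hξ hxy b g c) (Ioo (-ρ) ρ) :=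
    (viewProjection hξ hxy).contDiff.comp_contDiffOn ((hg.contDiffOn hξ hb).comp
      (contDiff_const.add contDiff_id).contDiffOn hmem)
  refine ⟨hρ, hcurve, ?_, ?_, ?_, ?_, ?_⟩
  · intro s hs
    rw [(hasDerivAt_frontCurve hξ hxy hb hg (hmem s hs)).deriv, LinearIndependent.pair_iff]
    intro a d h
    have h3 : b.coord 3 ((a • frontCurve hξ hxy b g c s + d • viewProjection hξ hxy
      (tangentLift ξ b (g (c + s))) : viewPlane ξ x y) : Fin 4 → ℝ) = 0 := by rw [h]; simp
    have h2 : b.coord 2 ((a • frontCurve hξ hxy b g c s + d • viewProjection hξ hxy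
      (tangentLift ξ b (g (c + s))) : viewPlane ξ x y) : Fin 4 → ℝ) = 0 := by rw [h]; simp
    rw [Submodule.coe_add, Submodule.coe_smul, Submodule.coe_smul, map_add, map_smul, map_smul,
      smul_eq_mul, smul_eq_mul] at h2 h3
    rw [coord_three_frontCurve hξ hxy hb hg (hmem s hs), (coord_viewProjection hξ hxy hb _).2.2,
      coord_three_tangentLift hξ hb (hg.ne _ (hmem s hs))] at h3
    have ha : a = 0 := by linarith
    rw [ha, (coord_viewProjection hξ hxy hb _).2.1,
      coord_two_tangentLift hξ hb (hg.ne _ (hmem s hs))] at h2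
    exact ⟨ha, by linarith⟩
  -- The affine coordinate of a line, shifted by `c`, is a continuous left inverse of the
  -- parametrization, which is therefore an embedding.
  · let F : Ioo (-ρ) ρ → chartDomain ((coordMap b ![3]).comp (viewPlane ξ x y).subtypeL) :=
      fun s => ⟨Submodule.span ℝ {frontCurve hξ hxy b g c s}, (hchart s s.2).1⟩
    have hF : Continuous F := by
      refine Continuous.subtype_mk ?_ _
      refine Continuous.congr (f := fun s : Ioo (-ρ) ρ => viewMap hξ hxy
        ((ξ (g (c + s))).piece 1)) ?_ fun s => (hspan s s.2).symm
      refine continuous_iff_continuousAt.2 fun s => ?_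
      have h1 : ContinuousAt (fun r : Ioo (-ρ) ρ => g (c + r)) s :=
        ContinuousAt.comp (g := g) (f := fun r : Ioo (-ρ) ρ => c + (r : ℝ))
          (hg.continuousAt (hmem s s.2)) (by fun_prop)
      have h2 : ContinuousAt (fun r : Ioo (-ρ) ρ => (ξ (g (c + r))).piece 1) s :=
        ContinuousAt.comp (g := fun w => (ξ w).piece 1) (f := fun r : Ioo (-ρ) ρ => g (c + r))
          (hξ.continuous_piece 1).continuousAt h1
      exact ContinuousAt.comp (g := viewMap hξ hxy)
        (continuousAt_viewMap hξ hxy (hg.ne _ (hmem s s.2)) one_le_two) h2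
    have hG : Continuous fun L : chartDomain ((coordMap b ![3]).comp (viewPlane ξ x y).subtypeL) =>
        lineCoord b (viewPlane ξ x y) L - c :=
      (continuousOn_iff_continuous_domRestrict.1 (continuousOn_lineCoord _)).sub continuous_const
    have hGF : (fun L : chartDomain ((coordMap b ![3]).comp (viewPlane ξ x y).subtypeL) =>
        lineCoord b (viewPlane ξ x y) L - c) ∘ F = Subtype.val := by
      funext s
      simp only [Function.comp_apply, F]
      rw [(hchart s s.2).2, coord_two_frontCurve hξ hxy hb hg (hmem s s.2)]
      ring
    exact IsEmbedding.subtypeVal.comp (IsEmbedding.of_comp hF hG (hGF ▸ IsEmbedding.subtypeVal))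
  · intro s hs
    exact ⟨⟨g (c + s), hg.ne _ (hmem s hs)⟩, (hspan s hs).symm⟩
  · have h0 : (0 : ℝ) ∈ Ioo (-ρ) ρ := ⟨by linarith, hρ⟩
    -- The neighbourhood consists of the lines with affine coordinate within `ρ` of `c`. A point of
    -- the curve in it has its parameter in the interval, so no distant part of the curve returns
    -- near `ξ¹(y)`.
    have hopen := (continuousOn_lineCoord (b := b) (viewPlane ξ x y)).isOpen_inter_preimage
      (isOpen_chartDomain _) (isOpen_Ioo (a := c - ρ) (b := c + ρ))
    have hy0 : viewMap hξ hxy ((ξ y).piece 1) = Submodule.span ℝ {frontCurve hξ hxy b g c 0} := by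
      rw [hspan 0 h0, add_zero, hgc]
    refine mem_nhdsWithin.2 ⟨_, hopen, ?_, ?_⟩
    · rw [hy0]
      refine ⟨(hchart 0 h0).1, ?_⟩
      rw [mem_preimage, (hchart 0 h0).2, coord_two_frontCurve hξ hxy hb hg (hmem 0 h0)]
      constructor <;> linarith
    · rintro _ ⟨⟨-, hL⟩, w, rfl⟩
      have hw3 : b.coord 3 (viewProjection hξ hxy (affineLift ξ b w.1) : Fin 4 → ℝ) = 1 := by
        rw [(coord_viewProjection hξ hxy hb _).2.2, coord_three_affineLift hξ hb w.2]
      have hwL := span_viewProjection_affineLift hξ hxy hb w.2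
      rw [mem_preimage] at hL
      simp only at hL
      rw [← hwL, (span_mem_chartDomain_and_lineCoord hw3).2,
        (coord_viewProjection hξ hxy hb _).2.1] at hL
      have hs : b.coord 2 (affineLift ξ b w.1) - c ∈ Ioo (-ρ) ρ :=
        ⟨by linarith [hL.1], by linarith [hL.2]⟩
      refine ⟨_, hs, ?_⟩
      simp only
      rw [hspan _ hs, add_sub_cancel, hg.inv _ w.2]
  · have h0 : (0 : ℝ) ∈ Ioo (-ρ) ρ := ⟨by linarith, hρ⟩
    rw [hspan 0 h0, add_zero, hgc]

lemma viewMap_piece_two_eq_span (hb : IsFrontBasis ξ x y b) {c : ℝ} (hgc : g c = y) :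
    viewMap hξ hxy ((ξ y).piece 2) = Submodule.span ℝ
      {frontCurve hξ hxy b g c 0, viewProjection hξ hxy (tangentLift ξ b (g c))} := by
  rw [frontCurve, add_zero, hgc, ← span_affineLift_tangentLift hξ hb hxy.symm, viewMap,
    Submodule.map_span, image_pair]
  rfl

theorem isC1AtWithTangent_frontCurve (hb : IsFrontBasis ξ x y b) (hg : IsFrontParam ξ x b J g)
    {c ρ : ℝ} (hρ : 0 < ρ) (hJ : Ioo (c - ρ) (c + ρ) ⊆ J) (hgc : g c = y) :
    IsC1AtWithTangent (range fun w : {w : X // w ≠ x} => viewMap hξ hxy ((ξ w).piece 1))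
      (viewMap hξ hxy ((ξ y).piece 1)) (viewMap hξ hxy ((ξ y).piece 2)) := by
  refine ⟨ρ, _, isC1LocalParam_frontCurve hξ hxy hb hg hρ hJ hgc, ?_⟩
  have hc : c + 0 ∈ J := hJ ⟨by linarith, by linarith⟩
  rw [(hasDerivAt_frontCurve hξ hxy hb hg hc).deriv, add_zero]
  exact viewMap_piece_two_eq_span hξ hxy hb hgc

theorem crossesLineAt_frontCurve (hb : IsFrontBasis ξ x y b) (hg : IsFrontParam ξ x b J g)
    {c ρ : ℝ} (hρ : 0 < ρ) (hJ : Ioo (c - ρ) (c + ρ) ⊆ J) (hgc : g c = y) {ε : ℝ} (hε : ε ≠ 0)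
    (hneg : ∀ s ∈ J, s < c → ε * (height ξ b g 0 s - height ξ b g 0 c -
      b.coord 0 (tangentLift ξ b (g c)) * (s - c)) < 0)
    (hpos : ∀ s ∈ J, c < s → 0 < ε * (height ξ b g 0 s - height ξ b g 0 c -
      b.coord 0 (tangentLift ξ b (g c)) * (s - c))) :
    CrossesLineAt (range fun w : {w : X // w ≠ x} => viewMap hξ hxy ((ξ w).piece 1))
      (viewMap hξ hxy ((ξ y).piece 1)) (viewMap hξ hxy ((ξ y).piece 2)) := by
  have hcJ : c ∈ J := hJ ⟨by linarith, by linarith⟩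
  have hc0 : c + 0 ∈ J := by rwa [add_zero]
  set m := b.coord 0 (tangentLift ξ b (g c)) with hm
  -- Homogenized equation `u - u(c) - m (t - c)` of the tangent at `y`, times `ε`: its sign on the
  -- curve tells on which side of the tangent the graph lies.
  let φ : viewPlane ξ x y →ₗ[ℝ] ℝ := (ε • (b.coord 0 - height ξ b g 0 c • b.coord 3 -
    m • (b.coord 2 - c • b.coord 3))) ∘ₗ (viewPlane ξ x y).subtype
  have hφ : ∀ q : viewPlane ξ x y, φ q = ε * (b.coord 0 (q : Fin 4 → ℝ) -
      height ξ b g 0 c * b.coord 3 (q : Fin 4 → ℝ) -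
      m * (b.coord 2 (q : Fin 4 → ℝ) - c * b.coord 3 (q : Fin 4 → ℝ))) := fun q => rfl
  have hφγ : ∀ s, c + s ∈ J → φ (frontCurve hξ hxy b g c s) =
      ε * (height ξ b g 0 (c + s) - height ξ b g 0 c - m * ((c + s) - c)) := by
    intro s hs
    rw [hφ, coord_two_frontCurve hξ hxy hb hg hs, coord_three_frontCurve hξ hxy hb hg hs,
      frontCurve, (coord_viewProjection hξ hxy hb _).1, mul_one, mul_one]
    rfl
  have ht0 := (coord_viewProjection hξ hxy hb (tangentLift ξ b (g c))).1
  have ht2 := (coord_viewProjection hξ hxy hb (tangentLift ξ b (g c))).2.1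
  have ht3 := (coord_viewProjection hξ hxy hb (tangentLift ξ b (g c))).2.2
  rw [coord_two_tangentLift hξ hb (hg.ne c hcJ)] at ht2
  rw [coord_three_tangentLift hξ hb (hg.ne c hcJ)] at ht3
  refine ⟨ρ, _, isC1LocalParam_frontCurve hξ hxy hb hg hρ hJ hgc, φ, ?_, ?_, ?_⟩
  · rw [viewMap_piece_two_eq_span hξ hxy hb hgc]
    refine le_antisymm (fun q hq => ?_) (Submodule.span_le.2 ?_)
    · have hq0 := (mul_eq_zero.1 ((hφ q).symm.trans hq)).resolve_left hε
      refine Submodule.mem_span_pair.2 ⟨b.coord 3 (q : Fin 4 → ℝ),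
        b.coord 2 (q : Fin 4 → ℝ) - c * b.coord 3 (q : Fin 4 → ℝ), ?_⟩
      refine viewPlane_ext hξ hxy hb ?_ ?_ ?_ <;>
        rw [Submodule.coe_add, Submodule.coe_smul, Submodule.coe_smul, map_add, map_smul, map_smul,
          smul_eq_mul, smul_eq_mul]
      · rw [ht0, ← hm, frontCurve, (coord_viewProjection hξ hxy hb _).1, add_zero]
        simp only [height] at hq0
        linear_combination -hq0
      · rw [coord_two_frontCurve hξ hxy hb hg hc0, ht2]
        ring
      · rw [coord_three_frontCurve hξ hxy hb hg hc0, ht3]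
        ring
    · rintro q (rfl | rfl)
      · refine (hφγ 0 hc0).trans ?_
        rw [add_zero]
        ring
      · refine (hφ _).trans ?_
        rw [ht0, ht2, ht3, ← hm]
        ring
  · intro s hs
    have hsJ : c + s ∈ J := hJ ⟨by linarith [hs.1], by linarith [hs.2]⟩
    rw [hφγ s hsJ]
    exact hneg _ hsJ (by linarith [hs.2])
  · intro s hs
    have hsJ : c + s ∈ J := hJ ⟨by linarith [hs.1], by linarith [hs.2]⟩
    rw [hφγ s hsJ]
    exact hpos _ hsJ (by linarith [hs.1])

end LocalParam

/-! ### Injectivity of the projected points and lines -/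

section FrontInjective

variable {X : Type*} [TopologicalSpace X] {ξ : X → FullFlag (Fin 4 → ℝ)} {x y : X}
  {b : Module.Basis (Fin 4) ℝ (Fin 4 → ℝ)} (hξ : IsHyperconvexFrenet ξ) (hxy : x ≠ y)

lemma viewMap_piece_one_injOn (hb : IsFrontBasis ξ x y b) :
    InjOn (fun w => viewMap hξ hxy ((ξ w).piece 1)) {x}ᶜ := by
  intro w hw w' hw' h
  simp only at h
  rw [← span_viewProjection_affineLift hξ hxy hb hw,
    ← span_viewProjection_affineLift hξ hxy hb hw'] at h
  have h3 : ∀ w ≠ x, b.coord 3 (viewProjection hξ hxy (affineLift ξ b w) : Fin 4 → ℝ) = 1 :=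
    fun w hw => by rw [(coord_viewProjection hξ hxy hb _).2.2, coord_three_affineLift hξ hb hw]
  have hl := congrArg (lineCoord b (viewPlane ξ x y)) h
  rw [(span_mem_chartDomain_and_lineCoord (h3 w hw)).2,
    (span_mem_chartDomain_and_lineCoord (h3 w' hw')).2, (coord_viewProjection hξ hxy hb _).2.1,
    (coord_viewProjection hξ hxy hb _).2.1] at hl
  exact injOn_coord_two_affineLift hξ hb hw hw' hl

/-- For distinct points, `ξ²(w)` and `ξ²(w')` span everything; equal images would both be the whole
plane, although their dimension is `2`. -/
lemma viewMap_piece_two_injOn :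
    InjOn (fun w => viewMap hξ hxy ((ξ w).piece 2)) {x}ᶜ := by
  intro w hw w' hw' h
  by_contra hne
  have htop : (ξ w).piece 2 ⊔ (ξ w').piece 2 = ⊤ :=
    Submodule.eq_top_of_disjoint _ _ (by simp [FullFlag.finrank_piece])
      (hξ.disjoint (k := 2) (m := 2) hne (by simp))
  have hrange : viewMap hξ hxy ⊤ = ⊤ := by
    rw [eq_top_iff]
    exact fun q _ => ⟨q, trivial, viewProjection_coe hξ hxy q⟩
  have h2 : viewMap hξ hxy ((ξ w).piece 2) = ⊤ := by
    rw [← hrange, ← htop, viewMap, viewMap, Submodule.map_sup]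
    exact (sup_eq_left.2 (ge_of_eq h)).symm
  have := finrank_viewMap hξ hxy hw le_rfl
  rw [h2, finrank_top, finrank_viewPlane hξ hxy] at this
  omega

end FrontInjective

end FrenetCurve

/-! ### The theorem -/

theorem lemma4p15 {X : Type*} [TopologicalSpace X] [CircularOrder X]
    (e : X ≃ₜ AddCircle (1 : ℝ)) (he : ∀ a b c : X, btw (e a) (e b) (e c) ↔ btw a b c)
    (ξ : X → FrenetCurve.FullFlag (Fin 4 → ℝ)) (hξ : FrenetCurve.IsHyperconvexFrenet ξ)
    (x y : X) (hxy : x ≠ y) :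
    -- `p_xy` is a point, `P_xy` is a plane, and they are complementary
    Module.finrank ℝ (FrenetCurve.viewPoint ξ x y) = 1 ∧
    Module.finrank ℝ (FrenetCurve.viewPlane ξ x y) = 3 ∧
    IsCompl (FrenetCurve.viewPoint ξ x y) (FrenetCurve.viewPlane ξ x y) ∧
    -- `σ_xy` is a well-defined map from the circle minus `x` to the full flags in `P_xy`
    ∃ σ : {w : X // w ≠ x} → FrenetCurve.FullFlag (FrenetCurve.viewPlane ξ x y),
      (∀ w, (σ w).piece 1 = FrenetCurve.frontProj ξ x y 1 w) ∧
      (∀ w, (σ w).piece 2 = FrenetCurve.frontProj ξ x y 2 w) ∧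
      -- continuity and injectivity of `σ¹` and `σ²`
      (Continuous (fun w => (σ w).piece 1) ∧ Function.Injective (fun w => (σ w).piece 1)) ∧
      (Continuous (fun w => (σ w).piece 2) ∧ Function.Injective (fun w => (σ w).piece 2)) ∧
      -- the restrictions to `(x, y]` and `[y, x)`
      FrenetCurve.IsHyperconvexFrenet
        (Set.domRestrict {w : {w : X // w ≠ x} | sbtw x w.1 y ∨ w.1 = y} σ) ∧
      FrenetCurve.IsHyperconvexFrenet
        (Set.domRestrict {w : {w : X // w ≠ x} | w.1 = y ∨ sbtw y w.1 x} σ) ∧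
      -- the image of `σ¹` at the point `ξ¹(y)`, with its tangent line `ξ²(y)`
      FrenetCurve.IsC1AtWithTangent (Set.range fun w => (σ w).piece 1)
        (((ξ y).piece 1).submoduleOf (FrenetCurve.viewPlane ξ x y))
        (((ξ y).piece 2).submoduleOf (FrenetCurve.viewPlane ξ x y)) ∧
      FrenetCurve.CrossesLineAt (Set.range fun w => (σ w).piece 1)
        (((ξ y).piece 1).submoduleOf (FrenetCurve.viewPlane ξ x y))
        (((ξ y).piece 2).submoduleOf (FrenetCurve.viewPlane ξ x y)) := by
  have hP := FrenetCurve.finrank_viewPlane hξ hxy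
  obtain ⟨b, hb⟩ := FrenetCurve.exists_isFrontBasis hξ hxy
  obtain ⟨J, g, hJ, hJc, hgc, hgJ, hgw, hord⟩ := FrenetCurve.exists_inverse_of_injOn e he x
    ((LinearMap.continuous_of_finiteDimensional (b.coord 2)).comp_continuousOn
      (FrenetCurve.continuousOn_affineLift hξ hb))
    (FrenetCurve.injOn_coord_two_affineLift hξ hb)
  have hg : FrenetCurve.IsFrontParam ξ x b J g :=
    ⟨hJ, hJc, hgc, fun s hs => (hgJ s hs).1, fun s hs => (hgJ s hs).2,
      fun w hw => (hgw w hw).1, fun w hw => (hgw w hw).2⟩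
  set c := b.coord 2 (FrenetCurve.affineLift ξ b y) with hc
  have hcJ : c ∈ J := hg.mem y hxy.symm
  have hgy : g c = y := hg.inv y hxy.symm
  obtain ⟨ε, hε, hleft, hright⟩ := hg.exists_sign hξ hb hcJ hgy
  have hε0 : ε ≠ 0 := by rcases hε with rfl | rfl <;> norm_num
  -- Both halves are closed at `c`, so each contains the parameter of `y`.
  have hTl : (J ∩ Iic c).OrdConnected := hJc.inter ordConnected_Iic
  have hTr : (J ∩ Ici c).OrdConnected := hJc.inter ordConnected_Ici
  have hl : ∀ r ∈ J ∩ Iic c, ∀ s ∈ J ∩ Iic c, r ≠ s → ε * (FrenetCurve.height ξ b g 0 s -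
      FrenetCurve.height ξ b g 0 r -
      b.coord 0 (FrenetCurve.tangentLift ξ b (g r)) * (s - r)) < 0 := by
    intro r hr s hs hrs
    -- On this side `ε * u` is strictly concave, so convexity is applied to `-ε * u`.
    have := FrenetCurve.tangent_lt_of_secondDiff_pos
      (u := fun s => -ε * FrenetCurve.height ξ b g 0 s) hTl
      (fun p hp q hq t ht h1 h2 => by
        rw [FrenetCurve.secondDiff_smul]
        linarith [hleft p hp.1 q hq.1 t ht.1 h1 h2 ht.2]) hr hs hrs
      ((hg.hasDerivAt_height hξ hb hr.1 0).const_mul (-ε))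
    linarith
  have hr : ∀ r ∈ J ∩ Ici c, ∀ s ∈ J ∩ Ici c, r ≠ s → 0 < ε * (FrenetCurve.height ξ b g 0 s -
      FrenetCurve.height ξ b g 0 r -
      b.coord 0 (FrenetCurve.tangentLift ξ b (g r)) * (s - r)) := by
    intro r hr s hs hrs
    have := FrenetCurve.tangent_lt_of_secondDiff_pos
      (u := fun s => ε * FrenetCurve.height ξ b g 0 s) hTr
      (fun p hp q hq t ht h1 h2 => by
        rw [FrenetCurve.secondDiff_smul]
        exact hright p hp.1 q hq.1 t ht.1 h1 h2 hp.2) hr hs hrs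
      ((hg.hasDerivAt_height hξ hb hr.1 0).const_mul ε)
    linarith
  obtain ⟨σ, hσ, hσ3⟩ := FrenetCurve.exists_frontFlag hξ hxy
  have hfl : ∀ I : Set {w : X // w ≠ x},
      (∀ w ∈ I, b.coord 2 (FrenetCurve.affineLift ξ b w.1) ∈ J ∩ Iic c) →
      FrenetCurve.IsHyperconvexFrenet (I.domRestrict σ) := fun I hI =>
    FrenetCurve.isHyperconvexFrenet_frontFlag hξ hxy hb hg hσ hσ3 inter_subset_left
      (fun p hp q hq t ht h1 h2 h0 => by
        simpa [h0] using hleft p hp.1 q hq.1 t ht.1 h1 h2 ht.2)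
      (fun p hp q hq hpq h0 => by
        have := hl p hp q hq hpq
        rw [h0, mul_zero] at this
        exact lt_irrefl _ this) hI
  have hfr : ∀ I : Set {w : X // w ≠ x},
      (∀ w ∈ I, b.coord 2 (FrenetCurve.affineLift ξ b w.1) ∈ J ∩ Ici c) →
      FrenetCurve.IsHyperconvexFrenet (I.domRestrict σ) := fun I hI =>
    FrenetCurve.isHyperconvexFrenet_frontFlag hξ hxy hb hg hσ hσ3 inter_subset_left
      (fun p hp q hq t ht h1 h2 h0 => by
        simpa [h0] using hright p hp.1 q hq.1 t ht.1 h1 h2 hp.2)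
      (fun p hp q hq hpq h0 => by
        have := hr p hp q hq hpq
        rw [h0, mul_zero] at this
        exact lt_irrefl _ this) hI
  have hcont : ∀ k, Continuous fun w => (σ w).piece k := fun k =>
    (continuous_apply k).comp
      (continuous_induced_dom.comp (FrenetCurve.continuous_frontFlag hξ hxy hσ hσ3))
  obtain ⟨ρ, hρ, hball⟩ := Metric.isOpen_iff.1 hJ c hcJ
  rw [Real.ball_eq_Ioo] at hball
  have hrange : (range fun w => (σ w).piece 1) = range fun w : {w : X // w ≠ x} =>
      FrenetCurve.viewMap hξ hxy ((ξ w).piece 1) :=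
    congrArg range (funext fun w => hσ w 1 one_le_two)
  rw [FrenetCurve.finrank_viewPoint hξ hxy, hP]
  refine ⟨rfl, rfl, (FrenetCurve.isCompl_viewPlane hξ hxy).symm, σ,
    fun w => (hσ w 1 one_le_two).trans (FrenetCurve.frontProj_eq_viewMap hξ hxy 1 w.1).symm,
    fun w => (hσ w 2 le_rfl).trans (FrenetCurve.frontProj_eq_viewMap hξ hxy 2 w.1).symm,
    ⟨hcont 1, ?_⟩, ⟨hcont 2, ?_⟩, ?_, ?_, ?_⟩
  · intro w w' h
    simp only [hσ _ 1 one_le_two] at h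
    exact Subtype.ext (FrenetCurve.viewMap_piece_one_injOn hξ hxy hb w.2 w'.2 h)
  · intro w w' h
    simp only [hσ _ 2 le_rfl] at h
    exact Subtype.ext (FrenetCurve.viewMap_piece_two_injOn hξ hxy w.2 w'.2 h)
  -- The parameter runs along the orientation or against it, and `(x, y]` is the lower or the upper
  -- half accordingly.
  · rcases hord with h | h
    · refine hfl _ fun w hw => ⟨hg.mem _ w.2, ?_⟩
      rcases hw with hw | hw
      · exact (h _ w.2 _ hxy.symm hw).le
      · simp [hw, hc]
    · refine hfr _ fun w hw => ⟨hg.mem _ w.2, ?_⟩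
      rcases hw with hw | hw
      · exact (h _ w.2 _ hxy.symm hw).le
      · simp [hw, hc]
  · rcases hord with h | h
    · refine hfr _ fun w hw => ⟨hg.mem _ w.2, ?_⟩
      rcases hw with hw | hw
      · simp [hw, hc]
      · exact (h _ hxy.symm _ w.2 (sbtw_cyclic.1 hw)).le
    · refine hfl _ fun w hw => ⟨hg.mem _ w.2, ?_⟩
      rcases hw with hw | hw
      · simp [hw, hc]
      · exact (h _ hxy.symm _ w.2 (sbtw_cyclic.1 hw)).le
  · rw [hrange, ← FrenetCurve.viewMap_eq_submoduleOf hξ hxy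
      (((ξ y).mono one_le_two).trans le_sup_left),
      ← FrenetCurve.viewMap_eq_submoduleOf hξ hxy le_sup_left]
    exact ⟨FrenetCurve.isC1AtWithTangent_frontCurve hξ hxy hb hg hρ hball hgy,
      FrenetCurve.crossesLineAt_frontCurve hξ hxy hb hg hρ hball hgy hε0
        (fun s hs hsc => hl c ⟨hcJ, self_mem_Iic⟩ s ⟨hs, hsc.le⟩ hsc.ne')
        (fun s hs hsc => hr c ⟨hcJ, self_mem_Ici⟩ s ⟨hs, hsc.le⟩ hsc.ne)⟩
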